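/- Let $R$ be a reduced irreducible (crystallographic) root system in a real vector space $V$, with simple roots $\alpha_1,\dots,\alpha_n$, Weyl group $W$, simple reflections $s_i=s_{\alpha_i}$, and weight lattice $P=\{\lambda\in V\mid \langle\lambda,\alpha^\vee\rangle\in\mathbb Z\text{ for all }\alpha\in R\}$. For $i\neq j$ let $m_{ij}$ be the order of $s_is_j$ (so that the hyperplanes orthogonal to $\alpha_i^\vee$ and $\alpha_j^\vee$ meet at the angle $\pi/m_{ij}$). Let $\mathbb K=\mathbb Z[q,q^{-1}]$, and let the affine Hecke algebra $\tilde H$ be the unital associative $\mathbb K$-algebra with generators $T_i$ ($1\le i\le n$) and $x^\lambda$ ($\lambda\in P$) and relations $$\underbrace{T_iT_jT_i\cdots}_{m_{ij}}=\underbrace{T_jT_iT_j\cdots}_{m_{ij}}\ (i\ne j),\qquad T_i^2=(q-q^{-1})T_i+1,$$ $$x^0=1,\qquad x^\lambda x^\mu=x^{\lambda+\mu},\qquad x^\lambda T_i=T_ix^{s_i\lambda}+(q-q^{-1})\frac{x^\lambda-x^{s_i\lambda}}{1-x^{-\alpha_i}},$$ for $1\le i\le n$ and $\lambda,\mu\in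 P$, where the fraction denotes the quotient in the group algebra $\mathbb K[P]$ of $P$, written in the generators $x^\mu$. Let $W$ act on $\mathbb K[P]$ by $w\bigl(\sum_\mu c_\mu x^\mu\bigr)=\sum_\mu c_\mu x^{w\mu}$. Then the canonical homomorphism $\mathbb K[P]\to\tilde H$, $x^\lambda\mapsto x^\lambda$, is injective, so that $\mathbb K[P]$ is a subalgebra of $\tilde H$, and the center of $\tilde H$ is $$Z(\tilde H)=\mathbb K[P]^W=\{f\in\mathbb K[P]\mid wf=f\text{ for all }w\in W\}.$$ -/

import Mathlib

noncomputable section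

namespace AffineHecke

section RootData

variable {ι V N : Type*} [AddCommGroup V] [Module ℝ V] [AddCommGroup N] [Module ℝ N]
  (Φ : RootPairing ι ℝ V N)

/-- The weight lattice: the vectors whose pairing with every coroot is an integer. -/
def weightLattice : AddSubgroup V where
  carrier := {v | ∀ j, ∃ m : ℤ, Φ.toLinearMap v (Φ.coroot j) = m}
  zero_mem' j := ⟨0, by simp⟩
  add_mem' {v w} hv hw j := by
    obtain ⟨a, ha⟩ := hv j
    obtain ⟨c, hc⟩ := hw j
    exact ⟨a + c, by simp [ha, hc]⟩
  neg_mem' {v} hv j := by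
    obtain ⟨a, ha⟩ := hv j
    exact ⟨-a, by simp [ha]⟩

variable {Φ} in
/-- The integer `⟨v, α_j^∨⟩`, for a weight `v`. -/
def pairZ (v : weightLattice Φ) (j : ι) : ℤ := (v.2 j).choose

variable {Φ} in
theorem pairZ_spec (v : weightLattice Φ) (j : ι) :
    Φ.toLinearMap (v : V) (Φ.coroot j) = (pairZ v j : ℝ) := (v.2 j).choose_spec

/-- The root `α_i`, as a weight. -/
def rootWeight [Φ.IsCrystallographic] (i : ι) : weightLattice Φ :=
  ⟨Φ.root i, fun j ↦ by
    obtain ⟨m, hm⟩ := Φ.exists_value (S := ℤ) i j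
    exact ⟨m, hm.symm⟩⟩

theorem weyl_smul_mem (w : Φ.weylGroup) {v : V} (hv : v ∈ weightLattice Φ) :
    w • v ∈ weightLattice Φ := by
  obtain ⟨w, hw⟩ := w
  change w • v ∈ weightLattice Φ
  induction hw using RootPairing.weylGroup.induction generalizing v with
  | mem i =>
    intro j
    obtain ⟨m, hm⟩ := hv (Φ.reflectionPerm i j)
    refine ⟨m, ?_⟩
    rw [← hm, RootPairing.Equiv.reflection_smul, RootPairing.coroot_reflectionPerm,
      RootPairing.reflection_apply, RootPairing.coreflection_apply]
    simp [mul_comm]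
  | one => simpa using hv
  | mul w₁ w₂ h₁ h₂ ih₁ ih₂ =>
    rw [mul_smul]
    exact ih₁ (ih₂ hv)

/-- The action of a Weyl group element on the weight lattice. -/
def weylMap (w : Φ.weylGroup) : weightLattice Φ →+ weightLattice Φ where
  toFun v := ⟨w • (v : V), weyl_smul_mem Φ w v.2⟩
  map_zero' := by ext; simp
  map_add' v v' := by ext; simp

/-- The reflection `s_i` in the root `α_i`, as an element of the Weyl group. -/
abbrev s (i : ι) : Φ.weylGroup := RootPairing.weylGroup.ofIdx Φ i

end RootData

/-- The ground ring `𝕂 = ℤ[q, q⁻¹]`. -/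
abbrev GroundRing : Type := LaurentPolynomial ℤ

/-- The element `q - q⁻¹` of `ℤ[q, q⁻¹]`. -/
def qSub : GroundRing := LaurentPolynomial.T 1 - LaurentPolynomial.T (-1)

section GroupAlgebra

variable {ι V N : Type*} [AddCommGroup V] [Module ℝ V] [AddCommGroup N] [Module ℝ N]
  (Φ : RootPairing ι ℝ V N)

/-- The group algebra `𝕂[P]` of the weight lattice. -/
abbrev WeightAlgebra : Type _ := AddMonoidAlgebra GroundRing (weightLattice Φ)

variable {Φ} in
/-- The basis element `x^v` of the group algebra `𝕂[P]`. -/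
def xP (v : weightLattice Φ) : WeightAlgebra Φ := AddMonoidAlgebra.single v 1

/-- The action of `w ∈ W` on `𝕂[P]`: `w (∑ c_v x^v) = ∑ c_v x^{wv}`. -/
def weylAct (w : Φ.weylGroup) : WeightAlgebra Φ →ₐ[GroundRing] WeightAlgebra Φ :=
  AddMonoidAlgebra.mapDomainAlgHom GroundRing GroundRing (weylMap Φ w)

/-- The ring `𝕂[P]^W` of `W`-invariant elements of `𝕂[P]`. -/
def invariants : Subalgebra GroundRing (WeightAlgebra Φ) where
  carrier := {f | ∀ w : Φ.weylGroup, weylAct Φ w f = f}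
  mul_mem' {f g} hf hg w := by rw [map_mul, hf w, hg w]
  add_mem' {f g} hf hg w := by rw [map_add, hf w, hg w]
  algebraMap_mem' c w := (weylAct Φ w).commutes c

variable [Φ.IsCrystallographic]

variable {Φ} in
/-- The quotient `(x^v - x^{s_i v}) / (1 - x^{-α_i})` in `𝕂[P]`; see `demazure_mul`.
With `m = ⟨v, α_i^∨⟩` it is `x^v + x^{v-α_i} + ⋯ + x^{v-(m-1)α_i}` if `m ≥ 0`, and
`-(x^{v+α_i} + ⋯ + x^{v-mα_i})` if `m ≤ 0`. -/
def demazure (i : ι) (v : weightLattice Φ) : WeightAlgebra Φ :=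
  ∑ k ∈ Finset.range (pairZ v i).toNat, xP (v - k • rootWeight Φ i)
    - ∑ k ∈ Finset.range (-pairZ v i).toNat, xP (v + (k + 1) • rootWeight Φ i)

variable {Φ} in
theorem demazure_mul (i : ι) (v : weightLattice Φ) :
    demazure i v * (1 - xP (-rootWeight Φ i)) = xP v - xP (weylMap Φ (s Φ i) v) := by
  have hs : weylMap Φ (s Φ i) v = v - pairZ v i • rootWeight Φ i := by
    ext
    change Φ.reflection i (v : V) = _
    rw [RootPairing.reflection_apply]
    simp [rootWeight, pairZ_spec, Int.cast_smul_eq_zsmul]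
  have hx : ∀ a c : weightLattice Φ, xP a * xP c = xP (a + c) := fun a c ↦ by
    simp [xP, AddMonoidAlgebra.single_mul_single]
  have h1 : ∀ n : ℕ, (∑ k ∈ Finset.range n, xP (v - k • rootWeight Φ i)) *
      (1 - xP (-rootWeight Φ i)) = xP v - xP (v - n • rootWeight Φ i) := fun n ↦ by
    induction n with
    | zero => simp
    | succ n ih =>
      rw [Finset.sum_range_succ, add_mul, ih, mul_sub, mul_one, hx, succ_nsmul]
      rw [show v - n • rootWeight Φ i + -rootWeight Φ i
        = v - (n • rootWeight Φ i + rootWeight Φ i) by abel]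
      abel
  have h2 : ∀ n : ℕ, (∑ k ∈ Finset.range n, xP (v + (k + 1) • rootWeight Φ i)) *
      (1 - xP (-rootWeight Φ i)) = xP (v + n • rootWeight Φ i) - xP v := fun n ↦ by
    induction n with
    | zero => simp
    | succ n ih =>
      rw [Finset.sum_range_succ, add_mul, ih, mul_sub, mul_one, hx, succ_nsmul]
      rw [show v + (n • rootWeight Φ i + rootWeight Φ i) + -rootWeight Φ i
        = v + n • rootWeight Φ i by abel]
      abel
  rw [demazure, sub_mul, h1, h2, hs]
  obtain ⟨n, hn | hn⟩ := (pairZ v i).eq_nat_or_neg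
  · simp [hn]
  · simp [hn]

end GroupAlgebra

section HeckeAlgebra

variable {ι V N : Type*} [AddCommGroup V] [Module ℝ V] [AddCommGroup N] [Module ℝ N]
  {Φ : RootPairing ι ℝ V N}

/-- The alternating product `a c a ⋯` with `n` factors. -/
def altProd {A : Type*} [Monoid A] (a c : A) : ℕ → A
  | 0 => 1
  | n + 1 => a * altProd c a n

/-- `m_{ij}`, the order of `s_i s_j`: the hyperplanes of two distinct simple roots `α_i`, `α_j`
meet at the angle `π / m_{ij}` and `s_i s_j` is a rotation by twice that angle. -/
def coxeterExponent (b : Φ.Base) (i j : b.support) : ℕ := orderOf (s Φ i * s Φ j)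

/-- The generators `T_i` (one for each simple root) and `x^v` (one for each weight). -/
inductive Generator (b : Φ.Base) : Type _
  | T (i : b.support) : Generator b
  | x (v : weightLattice Φ) : Generator b

/-- The free `𝕂`-algebra on the generators. -/
abbrev Free (b : Φ.Base) : Type _ := FreeAlgebra GroundRing (Generator b)

/-- The generator `T_i` in the free algebra. -/
def freeT (b : Φ.Base) (i : b.support) : Free b := FreeAlgebra.ι GroundRing (.T i)

/-- The generator `x^v` in the free algebra. -/
def freeX (b : Φ.Base) (v : weightLattice Φ) : Free b := FreeAlgebra.ι GroundRing (.x v)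

/-- The `𝕂`-linear map sending `∑ c_v x^v` in `𝕂[P]` to the same expression in the generators. -/
def freeLin (b : Φ.Base) (f : WeightAlgebra Φ) : Free b :=
  f.coeff.sum fun v c ↦ c • freeX b v

variable [Φ.IsCrystallographic]

/-- The defining relations of the affine Hecke algebra. -/
inductive Rel (b : Φ.Base) : Free b → Free b → Prop
  | braid (i j : b.support) (hij : i ≠ j) :
      Rel b (altProd (freeT b i) (freeT b j) (coxeterExponent b i j))
        (altProd (freeT b j) (freeT b i) (coxeterExponent b i j))
  | quadratic (i : b.support) : Rel b (freeT b i ^ 2) (qSub • freeT b i + 1)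
  | x_zero : Rel b (freeX b 0) 1
  | x_add (v w : weightLattice Φ) : Rel b (freeX b v * freeX b w) (freeX b (v + w))
  | bernstein (i : b.support) (v : weightLattice Φ) :
      Rel b (freeX b v * freeT b i)
        (freeT b i * freeX b (weylMap Φ (s Φ i) v) + qSub • freeLin b (demazure (i : ι) v))

/-- The affine Hecke algebra `H̃` over `𝕂`, given by generators and relations. -/
def HeckeAlgebra (b : Φ.Base) : Type _ := RingQuot (Rel b)

instance (b : Φ.Base) : Ring (HeckeAlgebra b) := inferInstanceAs (Ring (RingQuot (Rel b)))

instance (b : Φ.Base) : Algebra GroundRing (HeckeAlgebra b) :=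
  inferInstanceAs (Algebra GroundRing (RingQuot (Rel b)))

/-- The quotient map from the free algebra onto the affine Hecke algebra. -/
def mk (b : Φ.Base) : Free b →ₐ[GroundRing] HeckeAlgebra b := RingQuot.mkAlgHom GroundRing (Rel b)

/-- The element `x^v` of the affine Hecke algebra. -/
def xH (b : Φ.Base) (v : weightLattice Φ) : HeckeAlgebra b := mk b (freeX b v)

/-- The canonical homomorphism from the group algebra `𝕂[P]` to `H̃`, sending `x^v` to `x^v`. -/
def ofWeightAlgebra (b : Φ.Base) : WeightAlgebra Φ →ₐ[GroundRing] HeckeAlgebra b :=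
  AddMonoidAlgebra.lift GroundRing (HeckeAlgebra b) (weightLattice Φ)
    { toFun := fun v ↦ xH b v.toAdd
      map_one' := (RingQuot.mkAlgHom_rel GroundRing (Rel.x_zero (b := b))).trans (map_one (mk b))
      map_mul' := fun v w ↦ ((map_mul (mk b) _ _).symm.trans
        (RingQuot.mkAlgHom_rel GroundRing (Rel.x_add (b := b) v.toAdd w.toAdd))).symm }

end HeckeAlgebra

end AffineHecke

end

noncomputable section

namespace AffineHecke

/-! ### Weyl group: faithfulness, finiteness, length by inversions, exchange, reduced words. -/

section Weyl

variable {ι V N : Type*} [AddCommGroup V] [Module ℝ V] [AddCommGroup N] [Module ℝ N]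
  {Φ : RootPairing ι ℝ V N}

/-! The algebra acts faithfully enough on the fraction field of 𝕂[P], which is a field with an
action of W because P is torsion free. There x^λ acts by multiplication and T_i by the
Demazure–Lusztig operator q⁻¹((q² - c_i) + c_i s_i), with c_i = (1 - q² x^{-α_i})/(1 - x^{-α_i}).
Applying these operators to 1 shows at once that 𝕂[P] embeds (`ofWeightAlgebra_injective`).

The hard point is the braid relation (`altProd_demLus`). Both sides are combinations of elements of
the dihedral group of s_i and s_j. They agree on functions fixed by s_i or by s_j
(`altProd_demLus_apply_of_fixed`, from rational identities in types A1×A1, A2, B2, G2), so the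
coefficients of the difference change sign under right multiplication by s_i and s_j. They also
agree at the longest element, where the coefficient is a power of q⁻¹ times the product of c over
inversions. Hence the difference is zero.

For the center, the word property (`prod_map_eq_of_reduced`) defines T_w, and the sums ∑ f_w T_w
exhaust the algebra (`comb_surjective`). In the representation T_w is triangular: a nonzero multiple
of w plus shorter elements. Distinct elements of W are linearly independent over the field
(Dedekind), so a sum commuting with every x^λ has no component at u ≠ 1, and a longest w ≠ 1 with
f_w ≠ 0 would give one (`eq_zero_of_comb_commute`). A central element is thus some f in 𝕂[P].
Commutation with T_i, evaluated at 1, reads q⁻¹ c_i (s_i f - f) = 0, so f is invariant. Conversely,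
the correction term in the Bernstein relation vanishes for invariant f. -/

theorem root_smul_index (w : Φ.weylGroup) (j : ι) : Φ.root (w • j) = w • Φ.root j :=
  (Φ.weylGroup_apply_root w j).symm

theorem weyl_ext {w w' : Φ.weylGroup} (h : ∀ v : V, w • v = w' • v) : w = w' :=
  Subtype.ext (RootPairing.Equiv.weightHom_injective Φ (LinearEquiv.ext h))

theorem weyl_ext_root [Φ.IsRootSystem] {w w' : Φ.weylGroup}
    (h : ∀ j, w • Φ.root j = w' • Φ.root j) : w = w' := by
  refine Subtype.ext (RootPairing.Equiv.weightHom_injective Φ (LinearEquiv.toLinearMap_injective ?_))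
  refine LinearMap.ext_on_range (v := Φ.root) ?_ h
  exact RootPairing.IsRootSystem.span_root_eq_top

instance finite_weylGroup [Finite ι] [Φ.IsRootSystem] : Finite Φ.weylGroup := by
  refine Finite.of_injective (fun (w : Φ.weylGroup) (j : ι) ↦ w • j) fun w w' h ↦ ?_
  refine weyl_ext_root fun j ↦ ?_
  rw [← root_smul_index, ← root_smul_index, show w • j = w' • j from congrFun h j]

theorem s_smul_index (i j : ι) : s Φ i • j = Φ.reflectionPerm i j := rfl

theorem s_smul (i : ι) (v : V) : s Φ i • v = v - Φ.toLinearMap v (Φ.coroot i) • Φ.root i := by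
  change Φ.reflection i v = _
  rw [RootPairing.reflection_apply]
  rfl

@[simp]
theorem s_mul_self (i : ι) : s Φ i * s Φ i = 1 := by
  refine weyl_ext fun v ↦ ?_
  rw [mul_smul]
  change Φ.reflection i (Φ.reflection i v) = v
  simp

@[simp]
theorem s_inv (i : ι) : (s Φ i)⁻¹ = s Φ i := inv_eq_of_mul_eq_one_left (s_mul_self i)

@[simp]
theorem s_mul_cancel (i : ι) (w : Φ.weylGroup) : s Φ i * (s Φ i * w) = w := by
  rw [← mul_assoc, s_mul_self, one_mul]

theorem s_smul_index_eq (i j : ι) : s Φ (s Φ j • i) = s Φ j * s Φ i * s Φ j := by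
  refine weyl_ext fun v ↦ ?_
  rw [mul_smul, mul_smul]
  change Φ.reflection (Φ.reflectionPerm j i) v = Φ.reflection j (Φ.reflection i (Φ.reflection j v))
  rw [RootPairing.reflection_reflectionPerm]
  rfl

theorem root_s_smul_self (i : ι) : Φ.root (s Φ i • i) = -Φ.root i := by
  rw [s_smul_index]; simp

theorem weyl_smul_smul (w : Φ.weylGroup) (c : ℝ) (v : V) : w • (c • v) = c • (w • v) :=
  smul_comm w c v

/-! ### Positive roots and the length function -/

variable (b : Φ.Base)

section Height

variable [Φ.IsRootSystem]

/-- The linear functional equal to `1` on each simple root. -/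
def ht : V →ₗ[ℝ] ℝ := b.toWeightBasis.constr ℝ fun _ ↦ (1 : ℝ)

theorem ht_simple (i : b.support) : ht b (Φ.root i) = 1 := by
  rw [ht, ← b.toWeightBasis_apply i, Module.Basis.constr_basis]

theorem ht_root (j : ι) : ht b (Φ.root j) = b.height j := by
  obtain ⟨f, -, -, hf⟩ := b.exists_root_eq_sum_int j
  rw [RootPairing.Base.height_eq_sum hf, hf, map_sum, Int.cast_sum]
  refine Finset.sum_congr rfl fun i hi ↦ ?_
  rw [map_zsmul, ht_simple b ⟨i, hi⟩]
  simp

theorem isPos_iff_ht {j : ι} : b.IsPos j ↔ 0 < ht b (Φ.root j) := by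
  rw [ht_root, b.isPos_iff, Int.cast_pos]

theorem not_isPos_iff_ht {j : ι} : ¬ b.IsPos j ↔ ht b (Φ.root j) < 0 := by
  rw [ht_root, b.isPos_iff', Int.cast_lt_zero, not_le]

theorem isPos_iff_not_of_root_eq_neg {i j : ι} (h : Φ.root j = -Φ.root i) :
    b.IsPos j ↔ ¬ b.IsPos i := by
  rw [isPos_iff_ht, not_isPos_iff_ht, h, map_neg, neg_pos]

theorem isPos_smul_s_self (w : Φ.weylGroup) (i : ι) :
    b.IsPos (w • s Φ i • i) ↔ ¬ b.IsPos (w • i) := by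
  refine isPos_iff_not_of_root_eq_neg b ?_
  rw [root_smul_index, root_s_smul_self, smul_neg, root_smul_index]

theorem not_isPos_s_self (i : b.support) : ¬ b.IsPos (s Φ (i : ι) • (i : ι)) := by
  have := isPos_smul_s_self b 1 (i : ι)
  rw [one_smul, one_smul] at this
  rw [this, not_not]
  exact RootPairing.Base.isPos_of_mem_support i.2

end Height

/-- The set of positive roots made negative by `w⁻¹`. -/
def invSet (w : Φ.weylGroup) : Set ι := {j | b.IsPos j ∧ ¬ b.IsPos (w⁻¹ • j)}

@[simp]
theorem invSet_one : invSet b (1 : Φ.weylGroup) = ∅ := by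
  ext j; simp [invSet]

/-- The length of `w`: the number of positive roots made negative by `w⁻¹`. -/
def len (w : Φ.weylGroup) : ℕ := (invSet b w).ncard

@[simp]
theorem len_one : len b (1 : Φ.weylGroup) = 0 := by simp [len]

/-- The map j ↦ -w⁻¹j is a bijection from the inversions of w to those of w⁻¹. The negative of a
root k is written as `s Φ k • k`, its image under its own reflection. -/
theorem len_inv [Φ.IsRootSystem] (w : Φ.weylGroup) : len b w⁻¹ = len b w := by
  have key : ∀ w : Φ.weylGroup, ∀ j ∈ invSet b w,
      s Φ (w⁻¹ • j) • w⁻¹ • j ∈ invSet b w⁻¹ := by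
    rintro w j ⟨hj, hj'⟩
    have h1 := isPos_smul_s_self b 1 (w⁻¹ • j)
    have h2 := isPos_smul_s_self b w (w⁻¹ • j)
    rw [one_smul, one_smul] at h1
    rw [smul_inv_smul] at h2
    refine ⟨h1.2 hj', ?_⟩
    rw [inv_inv, h2, not_not]
    exact hj
  have inv : ∀ w : Φ.weylGroup, ∀ j, s Φ (w • s Φ (w⁻¹ • j) • w⁻¹ • j) •
      w • s Φ (w⁻¹ • j) • w⁻¹ • j = j := by
    intro w j
    apply Φ.root.injective
    rw [root_s_smul_self, root_smul_index, root_s_smul_self, smul_neg, root_smul_index,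
      smul_inv_smul, neg_neg]
  refine Set.ncard_congr (fun j _ ↦ s Φ (w • j) • w • j) ?_ ?_ ?_
  · intro j hj
    simpa using key w⁻¹ j hj
  · intro j k _ _ h
    have h1 := inv w⁻¹ j
    have h2 := inv w⁻¹ k
    simp only [inv_inv] at h1 h2
    rw [← h1, ← h2, h]
  · intro j hj
    exact ⟨s Φ (w⁻¹ • j) • w⁻¹ • j, key w j hj, inv w j⟩

variable {b} in
/-- The product of the simple reflections in a word. -/
def wprod (L : List b.support) : Φ.weylGroup := (L.map fun i : b.support ↦ s Φ (i : ι)).prod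

@[simp]
theorem wprod_nil : wprod ([] : List b.support) = 1 := rfl

@[simp]
theorem wprod_cons (i : b.support) (L : List b.support) :
    wprod (i :: L) = s Φ (i : ι) * wprod L := rfl

@[simp]
theorem wprod_append (L L' : List b.support) : wprod (L ++ L') = wprod L * wprod L' := by
  simp [wprod]

theorem notMem_image_invSet [Φ.IsRootSystem] (i : b.support) (w : Φ.weylGroup) :
    (i : ι) ∉ (s Φ (i : ι) • ·) '' invSet b w := by
  rintro ⟨k, ⟨hk, -⟩, hki⟩
  have : k = s Φ (i : ι) • (i : ι) := by
    rw [← inv_smul_eq_iff, s_inv]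
    exact hki
  exact not_isPos_s_self b i (this ▸ hk)

variable [Finite ι] [Φ.IsCrystallographic] [Φ.IsReduced]

theorem isPos_s_smul {i : b.support} {j : ι} (hj : b.IsPos j) (hij : j ≠ i) :
    b.IsPos (s Φ (i : ι) • j) := by
  rw [s_smul_index]; exact hj.reflectionPerm i.2 hij

theorem exists_wprod_eq_s (j : ι) : ∃ L : List b.support, wprod L = s Φ j := by
  refine b.induction_reflect j (p := fun j ↦ ∃ L : List b.support, wprod L = s Φ j) ?_ ?_ ?_
  · rintro i ⟨L, hL⟩
    exact ⟨L, by rw [hL, ← s_smul_index, s_smul_index_eq, s_mul_self, one_mul]⟩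
  · exact fun i hi ↦ ⟨[⟨i, hi⟩], by simp⟩
  · rintro i j ⟨L, hL⟩ hj
    exact ⟨⟨j, hj⟩ :: (L ++ [⟨j, hj⟩]), by
      rw [← s_smul_index, s_smul_index_eq]; simp [hL, mul_assoc]⟩

theorem exists_wprod_eq (w : Φ.weylGroup) : ∃ L : List b.support, wprod L = w := by
  obtain ⟨w, hw⟩ := w
  induction hw using RootPairing.weylGroup.induction with
  | mem i => exact exists_wprod_eq_s b i
  | one => exact ⟨[], rfl⟩
  | mul w₁ w₂ h₁ h₂ ih₁ ih₂ =>
    obtain ⟨L, hL⟩ := ih₁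
    obtain ⟨L', hL'⟩ := ih₂
    exact ⟨L ++ L', by rw [wprod_append, hL, hL']; rfl⟩

/-- A simple reflection s_i makes only one positive root negative, namely α_i. Following j through
the word, the letter at which it turns negative is the one to delete; the conjugation formula
`s_smul_index_eq` carries the reflection s_j to that place. -/
theorem exchange (L : List b.support) {j : ι} (hj : b.IsPos j)
    (h : ¬ b.IsPos ((wprod L)⁻¹ • j)) :
    ∃ L' : List b.support, L'.length + 1 = L.length ∧ wprod L' = s Φ j * wprod L := by
  induction L generalizing j with
  | nil => exact absurd hj (by simpa using h)
  | cons i L ih =>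
    by_cases hij : j = i
    · exact ⟨L, rfl, by rw [hij, wprod_cons, s_mul_cancel]⟩
    · rw [wprod_cons, mul_inv_rev, s_inv, mul_smul] at h
      obtain ⟨L', hL', h'⟩ := ih (isPos_s_smul b hj hij) h
      refine ⟨i :: L', by simp [hL'], ?_⟩
      rw [wprod_cons, h', s_smul_index_eq, wprod_cons]
      simp only [mul_assoc, s_mul_cancel]

variable [Φ.IsRootSystem]

/-- s_i permutes the positive roots other than α_i, so inversions are transported by s_i and only
α_i is new. Both the length formula and the recursion for `cInv` rest on this. -/
theorem invSet_s_mul {i : b.support} {w : Φ.weylGroup} (h : b.IsPos (w⁻¹ • (i : ι))) :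
    invSet b (s Φ (i : ι) * w) = insert (i : ι) ((s Φ (i : ι) • ·) '' invSet b w) := by
  ext j
  simp only [invSet, mul_inv_rev, s_inv, mul_smul, Set.mem_ofPred_eq, Set.mem_insert_iff,
    Set.mem_image]
  constructor
  · rintro ⟨hj, hj'⟩
    by_cases hij : j = i
    · exact Or.inl hij
    · refine Or.inr ⟨s Φ (i : ι) • j, ⟨isPos_s_smul b hj hij, hj'⟩, ?_⟩
      rw [← mul_smul, s_mul_self, one_smul]
  · rintro (rfl | ⟨k, ⟨hk, hk'⟩, rfl⟩)
    · refine ⟨RootPairing.Base.isPos_of_mem_support i.2, ?_⟩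
      rw [isPos_smul_s_self, not_not]
      exact h
    · refine ⟨isPos_s_smul b hk (by rintro rfl; exact hk' h), ?_⟩
      rwa [← mul_smul (s Φ (i : ι)), s_mul_self, one_smul]

theorem len_s_mul_of_isPos {i : b.support} {w : Φ.weylGroup} (h : b.IsPos (w⁻¹ • (i : ι))) :
    len b (s Φ (i : ι) * w) = len b w + 1 := by
  rw [len, invSet_s_mul b h, Set.ncard_insert_of_notMem (notMem_image_invSet b i w)
    (Set.toFinite _), Set.ncard_image_of_injective _ (MulAction.injective _), len]

theorem len_s_mul_of_not_isPos {i : b.support} {w : Φ.weylGroup}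
    (h : ¬ b.IsPos (w⁻¹ • (i : ι))) : len b (s Φ (i : ι) * w) + 1 = len b w := by
  have h' : b.IsPos ((s Φ (i : ι) * w)⁻¹ • (i : ι)) := by
    rw [mul_inv_rev, s_inv, mul_smul, isPos_smul_s_self]
    exact h
  have := len_s_mul_of_isPos b h'
  rw [s_mul_cancel] at this
  exact this.symm

theorem len_s_mul_le (i : b.support) (w : Φ.weylGroup) :
    len b (s Φ (i : ι) * w) ≤ len b w + 1 := by
  by_cases h : b.IsPos (w⁻¹ • (i : ι))
  · exact (len_s_mul_of_isPos b h).le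
  · have := len_s_mul_of_not_isPos b h
    omega

theorem len_mul_s_of_isPos {i : b.support} {w : Φ.weylGroup} (h : b.IsPos (w • (i : ι))) :
    len b (w * s Φ (i : ι)) = len b w + 1 := by
  rw [← len_inv, mul_inv_rev, s_inv, len_s_mul_of_isPos b (by rwa [inv_inv]), len_inv]

theorem len_wprod_le (L : List b.support) : len b (wprod L) ≤ L.length := by
  induction L with
  | nil => simp
  | cons i L ih =>
    rw [wprod_cons, List.length_cons]
    exact (len_s_mul_le b i _).trans (by omega)

theorem length_eq_len_or_exists_shorter (L : List b.support) :
    len b (wprod L) = L.length ∨ ∃ L' : List b.support, L'.length < L.length ∧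
      wprod L' = wprod L := by
  induction L with
  | nil => simp
  | cons i L ih =>
    rcases ih with ih | ⟨L', hL', h'⟩
    · by_cases h : b.IsPos ((wprod L)⁻¹ • (i : ι))
      · left
        rw [wprod_cons, len_s_mul_of_isPos b h, ih, List.length_cons]
      · right
        obtain ⟨L', hL', h'⟩ := exchange b L (RootPairing.Base.isPos_of_mem_support i.2) h
        exact ⟨L', by simp; omega, h'⟩
    · exact Or.inr ⟨i :: L', by simpa using hL', by rw [wprod_cons, h', wprod_cons]⟩

theorem exists_reduced_word (w : Φ.weylGroup) :
    ∃ L : List b.support, wprod L = w ∧ L.length = len b w := by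
  obtain ⟨L, hL⟩ := exists_wprod_eq b w
  induction hn : L.length using Nat.strong_induction_on generalizing L with
  | _ n ih =>
    rcases length_eq_len_or_exists_shorter b L with h | ⟨L', hL', h'⟩
    · exact ⟨L, hL, by rw [← hL, h]⟩
    · exact ih _ (hn ▸ hL') L' (h'.trans hL) rfl

end Weyl

/-! ### Alternating words and products. -/

section Alternating

variable {ι V N : Type*} [AddCommGroup V] [Module ℝ V] [AddCommGroup N] [Module ℝ N]
  {Φ : RootPairing ι ℝ V N} {b : Φ.Base}

/-- The alternating word `i j i ⋯` with `n` letters. -/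
def altList {α : Type*} (i j : α) : ℕ → List α
  | 0 => []
  | n + 1 => i :: altList j i n

theorem length_altList {α : Type*} (i j : α) (n : ℕ) : (altList i j n).length = n := by
  induction n generalizing i j with
  | zero => rfl
  | succ n ih => rw [altList, List.length_cons, ih]

theorem prod_map_altList {α A : Type*} [Monoid A] (T : α → A) (i j : α) (n : ℕ) :
    ((altList i j n).map T).prod = altProd (T i) (T j) n := by
  induction n generalizing i j with
  | zero => rfl
  | succ n ih => rw [altList, List.map_cons, List.prod_cons, ih, altProd]

theorem wprod_altList (i j : b.support) (n : ℕ) :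
    wprod (altList i j n) = altProd (s Φ (i : ι)) (s Φ (j : ι)) n :=
  prod_map_altList (fun i : b.support ↦ s Φ (i : ι)) i j n

theorem altProd_succ' {A : Type*} [Monoid A] (a c : A) (n : ℕ) :
    altProd a c (n + 1) = altProd a c n * if Even n then a else c := by
  induction n generalizing a c with
  | zero => simp [altProd]
  | succ n ih =>
    rw [altProd, ih, ← mul_assoc, altProd]
    by_cases h : Even n <;> simp [h, Nat.even_add_one]

theorem altProd_two_mul {A : Type*} [Monoid A] (a c : A) (n : ℕ) :
    altProd a c (2 * n) = (a * c) ^ n := by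
  induction n with
  | zero => simp [altProd]
  | succ n ih => rw [mul_add, mul_one, altProd, altProd, ih, pow_succ', mul_assoc]

theorem altProd_s_eq {i j : ι} {n : ℕ} (h : (s Φ i * s Φ j) ^ n = 1) :
    altProd (s Φ i) (s Φ j) n = altProd (s Φ j) (s Φ i) n := by
  have hinv : s Φ j * s Φ i = (s Φ i * s Φ j)⁻¹ := by rw [mul_inv_rev, s_inv, s_inv]
  obtain ⟨k, rfl | rfl⟩ := n.even_or_odd'
  · rw [altProd_two_mul, altProd_two_mul, hinv, inv_pow, eq_inv_iff_mul_eq_one, ← pow_add,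
      ← two_mul, h]
  · rw [altProd_succ', altProd_succ', altProd_two_mul, altProd_two_mul, if_pos (even_two_mul k),
      if_pos (even_two_mul k), hinv, inv_pow, eq_inv_mul_iff_mul_eq, ← mul_assoc, ← pow_add,
      ← two_mul, ← mul_left_inj (s Φ j), s_mul_self, mul_assoc, ← pow_succ, h]

end Alternating

/-! ### Rank two subsystems: classification, dihedral orders, lengths of alternating words. -/

section RankTwo

variable {ι V N : Type*} [AddCommGroup V] [Module ℝ V] [AddCommGroup N] [Module ℝ N]
  {Φ : RootPairing ι ℝ V N} {b : Φ.Base}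

/-- The vector v is arbitrary, so that relations between s_i and s_j can be checked on all of V by
tracking two coordinates, not just on the plane of the two roots. -/
theorem s_smul_comb {i j : ι} {p : ℝ} (hp : s Φ i • Φ.root j = Φ.root j + p • Φ.root i)
    (v : V) (x y : ℝ) :
    s Φ i • (v + x • Φ.root i + y • Φ.root j) =
      v + (p * y - x - Φ.toLinearMap v (Φ.coroot i)) • Φ.root i + y • Φ.root j := by
  have hi : s Φ i • Φ.root i = -Φ.root i := by rw [← root_smul_index, root_s_smul_self]
  rw [smul_add, smul_add, weyl_smul_smul, weyl_smul_smul, hp, hi, s_smul]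
  module

theorem s_smul_comb' {i j : ι} {r : ℝ} (hr : s Φ j • Φ.root i = Φ.root i + r • Φ.root j)
    (v : V) (x y : ℝ) :
    s Φ j • (v + x • Φ.root i + y • Φ.root j) =
      v + x • Φ.root i + (r * x - y - Φ.toLinearMap v (Φ.coroot j)) • Φ.root j := by
  rw [add_right_comm, s_smul_comb hr, add_right_comm]

theorem comb_congr {i j : ι} {v : V} {x y x' y' : ℝ} (hx : x = x') (hy : y = y') :
    v + x • Φ.root i + y • Φ.root j = v + x' • Φ.root i + y' • Φ.root j := by
  rw [hx, hy]

theorem comb_inj [Φ.IsRootSystem] {i j : b.support} (hij : i ≠ j) {x y x' y' : ℝ}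
    (h : (0 : V) + x • Φ.root i + y • Φ.root j = 0 + x' • Φ.root i + y' • Φ.root j) :
    x = x' ∧ y = y' := by
  have h1 := congrArg (fun v ↦ b.toWeightBasis.repr v i) h
  have h2 := congrArg (fun v ↦ b.toWeightBasis.repr v j) h
  simp [hij, hij.symm] at h1 h2
  exact ⟨h1, h2⟩

/-- The coefficients `p = -⟨α_j, α_i^∨⟩` and `r = -⟨α_i, α_j^∨⟩` are those of a rank two system
in which the product of the two simple reflections has order `m`. -/
inductive RankTwo : ℕ → ℕ → ℕ → Prop
  | A1A1 : RankTwo 2 0 0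
  | A2 : RankTwo 3 1 1
  | B2 : RankTwo 4 2 1
  | C2 : RankTwo 4 1 2
  | G2 : RankTwo 6 3 1
  | G2' : RankTwo 6 1 3

theorem s_smul_root [Φ.IsCrystallographic] (i j : ι) :
    s Φ i • Φ.root j = Φ.root j + ((-Φ.pairingIn ℤ j i : ℤ) : ℝ) • Φ.root i := by
  rw [s_smul]
  have : Φ.toLinearMap (Φ.root j) (Φ.coroot i) = ((Φ.pairingIn ℤ j i : ℤ) : ℝ) :=
    (Φ.algebraMap_pairingIn ℤ j i).symm
  rw [this]
  push_cast
  module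

theorem coe_ite_support (i j : b.support) (p : Prop) [Decidable p] :
    s Φ ((if p then i else j : b.support) : ι) = if p then s Φ (i : ι) else s Φ (j : ι) := by
  split_ifs <;> rfl

/-- A reduced crystallographic system allows finitely many pairs of Cartan integers, and those of
distinct simple roots are nonpositive; six pairs survive. -/
theorem exists_rankTwo [Finite ι] [Φ.IsCrystallographic] [Φ.IsReduced] {i j : b.support} (hij : i ≠ j) : ∃ m p r : ℕ, RankTwo m p r ∧
    s Φ (i : ι) • Φ.root j = Φ.root j + (p : ℝ) • Φ.root i ∧
    s Φ (j : ι) • Φ.root i = Φ.root i + (r : ℝ) • Φ.root j := by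
  have hij' : (i : ι) ≠ j := fun h ↦ hij (Subtype.ext h)
  have h0 := Φ.pairingIn_pairingIn_mem_set_of_isCrystal_of_isRed' (i := (i : ι)) (j := (j : ι))
    (fun h ↦ hij' (Φ.root.injective h)) (b.root_ne_neg_of_ne i.2 j.2 hij')
  have h1 := b.pairingIn_le_zero_of_ne hij' i.2 j.2
  have h2 := b.pairingIn_le_zero_of_ne hij'.symm j.2 i.2
  have e1 := s_smul_root (Φ := Φ) (i : ι) j
  have e2 := s_smul_root (Φ := Φ) (j : ι) i
  generalize Φ.pairingIn ℤ (i : ι) j = x at *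
  generalize Φ.pairingIn ℤ (j : ι) i = y at *
  simp only [Set.mem_insert_iff, Set.mem_singleton_iff, Prod.mk.injEq] at h0
  rcases h0 with ⟨rfl, rfl⟩ | ⟨rfl, rfl⟩ | ⟨rfl, rfl⟩ | ⟨rfl, rfl⟩ | ⟨rfl, rfl⟩ | ⟨rfl, rfl⟩ |
    ⟨rfl, rfl⟩ | ⟨rfl, rfl⟩ | ⟨rfl, rfl⟩ | ⟨rfl, rfl⟩ | ⟨rfl, rfl⟩ <;> try omega
  · exact ⟨_, _, _, .A1A1, by simpa using e1, by simpa using e2⟩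
  · exact ⟨_, _, _, .A2, by simpa using e1, by simpa using e2⟩
  · exact ⟨_, _, _, .B2, by simpa using e1, by simpa using e2⟩
  · exact ⟨_, _, _, .C2, by simpa using e1, by simpa using e2⟩
  · exact ⟨_, _, _, .G2, by simpa using e1, by simpa using e2⟩
  · exact ⟨_, _, _, .G2', by simpa using e1, by simpa using e2⟩

theorem coxeterExponent_eq [Φ.IsRootSystem] {i j : b.support} (hij : i ≠ j) {m p r : ℕ}
    (h : RankTwo m p r)
    (hp : s Φ (i : ι) • Φ.root j = Φ.root j + (p : ℝ) • Φ.root i)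
    (hr : s Φ (j : ι) • Φ.root i = Φ.root i + (r : ℝ) • Φ.root j) :
    coxeterExponent b i j = m := by
  have h1 : (s Φ (i : ι) * s Φ (j : ι)) ^ m = 1 := by
    refine weyl_ext fun v ↦ ?_
    rw [one_smul]
    have hv : v = v + (0 : ℝ) • Φ.root i + (0 : ℝ) • Φ.root j := by module
    rw [hv]
    cases h <;> simp only [pow_succ, pow_zero, one_mul, mul_smul, s_smul_comb hp,
      s_smul_comb' hr] <;> refine comb_congr ?_ ?_ <;> push_cast <;> ring
  have h2 : ∀ k, (s Φ (i : ι) * s Φ (j : ι)) ^ k = 1 →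
      (s Φ (i : ι) * s Φ (j : ι)) ^ k • ((0 : V) + (0 : ℝ) • Φ.root i + (1 : ℝ) • Φ.root j) =
        (0 : V) + (0 : ℝ) • Φ.root i + (1 : ℝ) • Φ.root j := by
    intro k hk
    rw [hk, one_smul]
  refine orderOf_eq_of_pow_and_pow_div_prime ?_ h1 ?_
  · cases h <;> norm_num
  · intro q hq hqm hk
    have hk := h2 _ hk
    have hq2 : q = 2 ∨ q = 3 := by
      -- 12 is a common multiple of the possible orders 2, 3, 4, 6.
      have : q ∣ 2 ^ 2 * 3 := hqm.trans (by cases h <;> norm_num)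
      rcases (Nat.Prime.dvd_mul hq).1 this with h | h
      · exact Or.inl ((Nat.prime_dvd_prime_iff_eq hq Nat.prime_two).1 (hq.dvd_of_dvd_pow h))
      · exact Or.inr ((Nat.prime_dvd_prime_iff_eq hq Nat.prime_three).1 h)
    cases h <;> rcases hq2 with rfl | rfl <;> try (revert hqm; decide)
    all_goals
      norm_num only [pow_succ, pow_zero, one_mul, mul_smul, s_smul_comb hp, s_smul_comb' hr] at hk
      have := comb_inj hij hk
      norm_num at this

variable [Finite ι] [Φ.IsRootSystem] [Φ.IsCrystallographic] [Φ.IsReduced]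

/-- This is the root that decides whether appending the next letter lengthens the alternating word.
Its lying in the cone of α_i and α_j serves twice: it is positive, and any w making both simple
roots negative makes it negative. -/
theorem exists_altProd_smul_eq {i j : b.support} (hij : i ≠ j) {k : ℕ}
    (hk : k < coxeterExponent b i j) :
    ∃ x y : ℝ, 0 ≤ x ∧ 0 ≤ y ∧
      altProd (s Φ (i : ι)) (s Φ (j : ι)) k • Φ.root ((if Even k then i else j : b.support) : ι) =
        (0 : V) + x • Φ.root i + y • Φ.root j := by
  obtain ⟨m, p, r, h, hp, hr⟩ := exists_rankTwo hij
  rw [coxeterExponent_eq hij h hp hr] at hk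
  have he : Φ.root ((if Even k then i else j : b.support) : ι) =
      (0 : V) + (if Even k then (1 : ℝ) else 0) • Φ.root i
      + (if Even k then (0 : ℝ) else 1) • Φ.root j := by
    split_ifs <;> module
  rw [he]
  cases h <;> interval_cases k <;>
    simp only [altProd, mul_one, one_smul, mul_smul, s_smul_comb hp, s_smul_comb' hr] <;>
    refine ⟨_, _, ?_, ?_, rfl⟩ <;> norm_num [Nat.even_iff]

theorem isPos_altProd_smul {i j : b.support} (hij : i ≠ j) {k : ℕ}
    (hk : k < coxeterExponent b i j) :
    b.IsPos (altProd (s Φ (i : ι)) (s Φ (j : ι)) k • ((if Even k then i else j : b.support) : ι)) := by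
  obtain ⟨x, y, hx, hy, h⟩ := exists_altProd_smul_eq hij hk
  by_contra hneg
  rw [not_isPos_iff_ht, root_smul_index, h] at hneg
  simp only [map_add, map_smul, ht_simple, smul_eq_mul, mul_one, zero_add] at hneg
  linarith

theorem not_isPos_smul_altProd_smul {i j : b.support} (hij : i ≠ j) {k : ℕ}
    (hk : k < coxeterExponent b i j) {w : Φ.weylGroup} (hi : ¬ b.IsPos (w • (i : ι)))
    (hj : ¬ b.IsPos (w • (j : ι))) :
    ¬ b.IsPos (w • altProd (s Φ (i : ι)) (s Φ (j : ι)) k •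
      ((if Even k then i else j : b.support) : ι)) := by
  obtain ⟨x, y, hx, hy, h⟩ := exists_altProd_smul_eq hij hk
  rw [not_isPos_iff_ht, root_smul_index] at hi hj
  rw [isPos_iff_ht, root_smul_index, root_smul_index, h, smul_add, smul_add, weyl_smul_smul,
    weyl_smul_smul]
  simp only [smul_zero, map_add, map_smul, smul_eq_mul, zero_add, not_lt]
  nlinarith

theorem len_altProd {i j : b.support} (hij : i ≠ j) {k : ℕ} (hk : k ≤ coxeterExponent b i j) :
    len b (altProd (s Φ (i : ι)) (s Φ (j : ι)) k) = k := by
  induction k with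
  | zero => simp [altProd]
  | succ k ih =>
    rw [altProd_succ', ← coe_ite_support, len_mul_s_of_isPos b (isPos_altProd_smul hij hk),
      ih (by omega)]

/-- If s_i and s_j both shorten w from the left, the whole alternating word of length m_{ij} splits
off w with lengths adding. -/
theorem len_inv_altProd_mul {i j : b.support} (hij : i ≠ j) {w : Φ.weylGroup}
    (hi : ¬ b.IsPos (w⁻¹ • (i : ι))) (hj : ¬ b.IsPos (w⁻¹ • (j : ι))) {k : ℕ}
    (hk : k ≤ coxeterExponent b i j) :
    len b ((altProd (s Φ (i : ι)) (s Φ (j : ι)) k)⁻¹ * w) + k = len b w := by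
  induction k with
  | zero => simp [altProd]
  | succ k ih =>
    rw [← ih (by omega), altProd_succ', mul_inv_rev, mul_assoc, ← coe_ite_support, s_inv,
      ← len_s_mul_of_not_isPos b (i := if Even k then i else j)
        (w := (altProd (s Φ (i : ι)) (s Φ (j : ι)) k)⁻¹ * w)]
    · ring
    · rw [mul_inv_rev, inv_inv, mul_smul]
      exact not_isPos_smul_altProd_smul hij hk hi hj

/-! ### Independence of the reduced word -/

theorem len_wprod_tail {i : b.support} {L : List b.support}
    (h : len b (wprod (i :: L)) = (i :: L).length) : len b (wprod L) = L.length := by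
  have h1 := len_wprod_le b L
  have h2 := len_s_mul_le b i (wprod L)
  rw [wprod_cons, List.length_cons] at h
  omega

theorem not_isPos_of_reduced {i : b.support} {L : List b.support}
    (h : len b (wprod (i :: L)) = (i :: L).length) :
    ¬ b.IsPos ((wprod (i :: L))⁻¹ • (i : ι)) := by
  intro hpos
  have h1 := len_s_mul_of_isPos b hpos
  have h2 := len_wprod_tail h
  rw [wprod_cons, s_mul_cancel, ← wprod_cons, h, List.length_cons] at h1
  omega

/-- Matsumoto's theorem, by induction on length. If the first letters i, j differ, both are left
descents of w, so w has reduced words beginning with either alternating word of length m_{ij} and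
sharing a tail Y. The braid relation links these two, and each shares its first letter with one of
the given words. -/
theorem prod_map_eq_of_reduced {M : Type*} [Monoid M] {T : b.support → M}
    (hT : ∀ i j, i ≠ j → altProd (T i) (T j) (coxeterExponent b i j) =
      altProd (T j) (T i) (coxeterExponent b i j))
    {L L' : List b.support} (hL : len b (wprod L) = L.length)
    (hL' : len b (wprod L') = L'.length) (h : wprod L = wprod L') :
    (L.map T).prod = (L'.map T).prod := by
  induction hn : L.length generalizing L L' with
  | zero =>
    have hn' : L'.length = 0 := by rw [← hL', ← h, hL, hn]
    rw [List.length_eq_zero_iff.1 hn, List.length_eq_zero_iff.1 hn']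
  | succ n ih =>
    have same : ∀ {i : b.support} {K K' : List b.support}, K.length = n →
        len b (wprod (i :: K)) = (i :: K).length → len b (wprod (i :: K')) = (i :: K').length →
        wprod (i :: K) = wprod (i :: K') → ((i :: K).map T).prod = ((i :: K').map T).prod := by
      intro i K K' hK h1 h2 h3
      rw [List.map_cons, List.map_cons, List.prod_cons, List.prod_cons,
        ih (len_wprod_tail h1) (len_wprod_tail h2) (mul_left_cancel h3) hK]
    obtain _ | ⟨i, K⟩ := L
    · simp at hn
    obtain _ | ⟨j, K'⟩ := L'
    · rw [h, hL'] at hL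
      simp at hL
    have hK : K.length = n := by simpa using hn
    have hK' : K'.length = n := by
      rw [h, hL'] at hL
      simp only [List.length_cons] at hL
      omega
    by_cases hij : i = j
    · subst hij
      exact same hK hL hL' h
    · have hi := not_isPos_of_reduced hL
      have hj := not_isPos_of_reduced hL'
      rw [← h] at hj
      have hy := len_inv_altProd_mul hij hi hj le_rfl
      obtain ⟨Y, hY, hYlen⟩ := exists_reduced_word b
        ((altProd (s Φ (i : ι)) (s Φ (j : ι)) (coxeterExponent b i j))⁻¹ * wprod (i :: K))
      have halt : altProd (s Φ (i : ι)) (s Φ (j : ι)) (coxeterExponent b i j) =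
          altProd (s Φ (j : ι)) (s Φ (i : ι)) (coxeterExponent b i j) :=
        altProd_s_eq (pow_orderOf_eq_one _)
      have e1 : wprod (altList i j (coxeterExponent b i j) ++ Y) = wprod (i :: K) := by
        rw [wprod_append, wprod_altList, hY, mul_inv_cancel_left]
      have e2 : wprod (altList j i (coxeterExponent b i j) ++ Y) = wprod (j :: K') := by
        rw [wprod_append, wprod_altList, ← halt, hY, mul_inv_cancel_left, h]
      have l1 : (altList i j (coxeterExponent b i j) ++ Y).length = (i :: K).length := by
        rw [List.length_append, length_altList, hYlen, add_comm, hy, hL]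
      have l2 : (altList j i (coxeterExponent b i j) ++ Y).length = (j :: K').length := by
        rw [List.length_append, length_altList, hYlen, add_comm, hy, h, hL']
      have hT' : ((altList i j (coxeterExponent b i j) ++ Y).map T).prod =
          ((altList j i (coxeterExponent b i j) ++ Y).map T).prod := by
        rw [List.map_append, List.prod_append, prod_map_altList, hT i j hij,
          List.map_append, List.prod_append, prod_map_altList]
      -- m_{ij} is nonzero because W is finite; this is what gives the alternating words a first
      -- letter for `same`.
      have hpos : 0 < coxeterExponent b i j := orderOf_pos _
      obtain ⟨m, hm⟩ := Nat.exists_eq_succ_of_ne_zero hpos.ne'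
      rw [hm] at e1 e2 l1 l2 hT'
      rw [Nat.succ_eq_add_one, altList, altList, List.cons_append, List.cons_append] at *
      rw [same hK hL (by rw [e1, hL, l1]) e1.symm, hT',
        same hK' hL' (by rw [e2, hL', l2]) e2.symm]

end RankTwo

/-! ### Rank two identities for the operators `f ↦ (t - a) f + a σ(f)` -/

section Scalar

variable {F : Type*} [CommRing F]

/-- The operator `f ↦ (t - a) f + a σ(f)`. -/
def dl (t a : F) (σ : F →+* F) (f : F) : F := (t - a) * f + a * σ f

theorem dl_eq_of_fixed {t a : F} {σ : F →+* F} {f : F} (h : σ f = f) : dl t a σ f = t * f := by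
  rw [dl, h]; ring

/-- Used with σ = s_i, τ = s_j and a, b, c, … the values of c at positive roots of the rank two
system; f, f₁, … is the orbit of a σ-fixed f. Expanding along the orbit, the claim follows from `R`
and its image under a reflection. The same pattern serves B2 and G2. -/
theorem fixed_A2 {σ τ : F →+* F} {t a b c : F} (hσt : σ t = t) (hτt : τ t = t)
    (hσb : σ b = c) (hτa : τ a = c) (hτb : τ b = 1 + t - b) (hτc : τ c = a)
    (R : (t - c) * (1 + t - b) = (t - a) * (t - b) + a * (t - c))
    {f f₁ f₂ : F} (h₀ : σ f = f) (h₁ : τ f = f₁) (h₂ : σ f₁ = f₂) (h₁' : τ f₁ = f)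
    (h₃ : τ f₂ = f₂) :
    τ (dl t a σ (dl t b τ f)) = dl t a σ (dl t b τ f) := by
  have R' := congrArg τ R
  simp only [dl, map_add, map_mul, map_sub, map_one, hσt, hτt, hσb, hτa, hτb, hτc, h₀, h₁, h₂,
    h₁', h₃] at R' ⊢
  linear_combination f * R - f₁ * R'

theorem fixed_B2 {σ τ : F →+* F} {t a b c d : F} (hσt : σ t = t) (hτt : τ t = t)
    (hσa : σ a = 1 + t - a) (hσb : σ b = d) (hσc : σ c = c) (hσd : σ d = b)
    (hτa : τ a = c) (hτb : τ b = 1 + t - b) (hτd : τ d = d)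
    (R : (t - b) * (t - a) + (t - c) * (b - 1) + c * (t - d) = (t - d) * (1 + t - a))
    {f f₁ f₂ f₃ : F} (h₀ : σ f = f) (h₁ : τ f = f₁) (h₂ : σ f₁ = f₂) (h₃ : τ f₂ = f₃)
    (h₁' : τ f₁ = f) (h₂' : σ f₂ = f₁) (h₄ : σ f₃ = f₃) :
    σ (dl t b τ (dl t a σ (dl t b τ f))) = dl t b τ (dl t a σ (dl t b τ f)) := by
  have R' := congrArg σ R
  simp only [dl, map_add, map_mul, map_sub, map_one, hσt, hτt, hσa, hσb, hσc, hσd, hτa, hτb, hτd,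
    h₀, h₁, h₂, h₃, h₁', h₂', h₄] at R' ⊢
  linear_combination -b * (f₁ - f) * R + d * (f₂ - f) * R'

/-- Five factors need a second identity: `S` and its σ-image take care of the terms in f₁ - f and f₂
- f, `R` and its σ-image of those in f₃ - f and f₄ - f. -/
theorem fixed_G2 {σ τ : F →+* F} {t a b c d e g : F} (hσt : σ t = t) (hτt : τ t = t)
    (hσa : σ a = 1 + t - a) (hσb : σ b = e) (hσc : σ c = d) (hσd : σ d = c) (hσe : σ e = b)
    (hσg : σ g = g) (hτa : τ a = c) (hτb : τ b = 1 + t - b) (hτc : τ c = a) (hτd : τ d = d)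
    (hτe : τ e = g) (hτg : τ g = e)
    (R : (t - b) * (t - a) + (t - c) * (b - 1) + (t - g) * (c - 1) + (t - d) * (g - 1)
      + d * (t - e) = (t - e) * (1 + t - a))
    (S : (t - e) * ((a - 1) * ((t - e) * (a - 1) + (t - d) * (e - 1) + d * (t - g))
        + (1 + t - a) * (t - b) * a)
      + (t - d) * ((e - 1) * ((t - d) * (e - 1) + d * (t - g)) + (1 + t - e) * (a - 1) * e)
      + d * ((t - g) * ((d - 1) * (t - g) + (1 + t - d) * (e - 1)) + g * (t - c) * (1 + t - g))
      = a * ((t - b) * ((t - a) * (t - b) + (t - e) * (a - 1) + (t - d) * (e - 1) + d * (t - g))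
        + b * (t - c) * (1 + t - b)))
    {f f₁ f₂ f₃ f₄ f₅ : F} (h₀ : σ f = f) (h₁ : τ f = f₁) (h₂ : σ f₁ = f₂) (h₃ : τ f₂ = f₃)
    (h₄ : σ f₃ = f₄) (h₅ : τ f₄ = f₅) (h₁' : τ f₁ = f) (h₂' : σ f₂ = f₁) (h₃' : τ f₃ = f₂)
    (h₄' : σ f₄ = f₃) (h₆ : σ f₅ = f₅) :
    σ (dl t b τ (dl t a σ (dl t b τ (dl t a σ (dl t b τ f))))) =
      dl t b τ (dl t a σ (dl t b τ (dl t a σ (dl t b τ f)))) := by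
  have R' := congrArg σ R
  have S' := congrArg σ S
  simp only [dl, map_add, map_mul, map_sub, map_one, hσt, hτt, hσa, hσb, hσc, hσd, hσe, hσg,
    hτa, hτb, hτc, hτd, hτe, hτg, h₀, h₁, h₂, h₃, h₄, h₅, h₁', h₂', h₃', h₄', h₆] at R' S' ⊢
  linear_combination e * (f₂ - f) * S - b * (f₁ - f) * S' - b * c * g * (f₃ - f) * R
    + e * d * g * (f₄ - f) * R'

end Scalar

/-! ### Rational function identities for c in X = x^{-α_i}, Y = x^{-α_j}. -/

section Identities

variable {F : Type*} [Field F]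

/-- The function `X ↦ (1 - t X) / (1 - X)`. -/
def cfun (t X : F) : F := (1 - t * X) / (1 - X)

theorem cfun_inv {t X : F} (h0 : X ≠ 0) (h : 1 - X ≠ 0) : cfun t X⁻¹ = 1 + t - cfun t X := by
  have : X - 1 ≠ 0 := by rw [← neg_sub]; exact neg_ne_zero.2 h
  rw [cfun, cfun]
  field_simp
  ring

theorem map_cfun (σ : F →+* F) {t : F} (ht : σ t = t) (X : F) :
    σ (cfun t X) = cfun t (σ X) := by
  rw [cfun, cfun, map_div₀, map_sub, map_sub, map_mul, map_one, ht]

variable {t X Y : F}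

variable {a b c d e g : F}

theorem cfun_rel_A2 (hX : 1 - X ≠ 0) (hY : 1 - Y ≠ 0) (hXY : 1 - X * Y ≠ 0)
    (ha : a = cfun t X) (hb : b = cfun t Y) (hc : c = cfun t (X * Y)) :
    (t - c) * (1 + t - b) = (t - a) * (t - b) + a * (t - c) := by
  simp only [ha, hb, hc, cfun]
  field_simp
  ring

theorem cfun_rel_B2 (hX : 1 - X ≠ 0) (hY : 1 - Y ≠ 0) (hXY : 1 - X * Y ≠ 0)
    (h : 1 - X ^ 2 * Y ≠ 0) (ha : a = cfun t X) (hb : b = cfun t Y) (hc : c = cfun t (X * Y))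
    (hd : d = cfun t (X ^ 2 * Y)) :
    (t - b) * (t - a) + (t - c) * (b - 1) + c * (t - d) = (t - d) * (1 + t - a) := by
  have : 1 - Y * X ≠ 0 := by rwa [mul_comm]
  have : 1 - Y * X ^ 2 ≠ 0 := by rwa [mul_comm]
  simp only [ha, hb, hc, hd, cfun]
  field_simp
  ring

/-- Same relation as `cfun_rel_B2` with long and short simple roots exchanged: c and d now belong to
α_i + 2α_j and α_i + α_j. -/
theorem cfun_rel_B2_dual (hX : 1 - X ≠ 0) (hY : 1 - Y ≠ 0) (hXY : 1 - X * Y ≠ 0)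
    (h : 1 - X * Y ^ 2 ≠ 0) (ha : a = cfun t X) (hb : b = cfun t Y)
    (hc : c = cfun t (X * Y ^ 2)) (hd : d = cfun t (X * Y)) :
    (t - b) * (t - a) + (t - c) * (b - 1) + c * (t - d) = (t - d) * (1 + t - a) := by
  have : 1 - Y * X ≠ 0 := by rwa [mul_comm]
  have : 1 - Y ^ 2 * X ≠ 0 := by rwa [mul_comm]
  simp only [ha, hb, hc, hd, cfun]
  field_simp
  ring

theorem cfun_rel_G2 (hX : 1 - X ≠ 0) (hY : 1 - Y ≠ 0) (hXY : 1 - X * Y ≠ 0)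
    (ha : a = cfun t X) (hb : b = cfun t Y) (hc : c = cfun t (X * Y))
    (hd : d = cfun t (X ^ 2 * Y)) (he : e = cfun t (X ^ 3 * Y)) (hg : g = cfun t (X ^ 3 * Y ^ 2))
    (h₁ : 1 - X ^ 2 * Y ≠ 0) (h₂ : 1 - X ^ 3 * Y ≠ 0) (h₃ : 1 - X ^ 3 * Y ^ 2 ≠ 0) :
    (t - b) * (t - a) + (t - c) * (b - 1) + (t - g) * (c - 1) + (t - d) * (g - 1)
      + d * (t - e) = (t - e) * (1 + t - a) := by
  have : 1 - Y * X ≠ 0 := by rwa [mul_comm]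
  have : 1 - Y * X ^ 2 ≠ 0 := by rwa [mul_comm]
  have : 1 - Y * X ^ 3 ≠ 0 := by rwa [mul_comm]
  have : 1 - Y ^ 2 * X ^ 3 ≠ 0 := by rwa [mul_comm]
  simp only [ha, hb, hc, hd, he, hg, cfun]
  field_simp
  ring

theorem cfun_rel_G2_dual (hX : 1 - X ≠ 0) (hY : 1 - Y ≠ 0) (hXY : 1 - X * Y ≠ 0)
    (ha : a = cfun t X) (hb : b = cfun t Y) (hc : c = cfun t (X * Y ^ 3))
    (hd : d = cfun t (X ^ 2 * Y ^ 3)) (he : e = cfun t (X * Y)) (hg : g = cfun t (X * Y ^ 2))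
    (h₁ : 1 - X * Y ^ 2 ≠ 0) (h₂ : 1 - X * Y ^ 3 ≠ 0) (h₃ : 1 - X ^ 2 * Y ^ 3 ≠ 0) :
    (t - b) * (t - a) + (t - c) * (b - 1) + (t - g) * (c - 1) + (t - d) * (g - 1)
      + d * (t - e) = (t - e) * (1 + t - a) := by
  have : 1 - Y * X ≠ 0 := by rwa [mul_comm]
  have : 1 - Y ^ 2 * X ≠ 0 := by rwa [mul_comm]
  have : 1 - Y ^ 3 * X ≠ 0 := by rwa [mul_comm]
  have : 1 - Y ^ 3 * X ^ 2 ≠ 0 := by rwa [mul_comm]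
  simp only [ha, hb, hc, hd, he, hg, cfun]
  field_simp
  ring

theorem cfun_rel_G2' (hX : 1 - X ≠ 0) (hY : 1 - Y ≠ 0) (hXY : 1 - X * Y ≠ 0)
    (ha : a = cfun t X) (hb : b = cfun t Y) (hc : c = cfun t (X * Y))
    (hd : d = cfun t (X ^ 2 * Y)) (he : e = cfun t (X ^ 3 * Y)) (hg : g = cfun t (X ^ 3 * Y ^ 2))
    (h₁ : 1 - X ^ 2 * Y ≠ 0) (h₂ : 1 - X ^ 3 * Y ≠ 0) (h₃ : 1 - X ^ 3 * Y ^ 2 ≠ 0) :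
    (t - e) * ((a - 1) * ((t - e) * (a - 1) + (t - d) * (e - 1) + d * (t - g))
        + (1 + t - a) * (t - b) * a)
      + (t - d) * ((e - 1) * ((t - d) * (e - 1) + d * (t - g)) + (1 + t - e) * (a - 1) * e)
      + d * ((t - g) * ((d - 1) * (t - g) + (1 + t - d) * (e - 1)) + g * (t - c) * (1 + t - g))
      = a * ((t - b) * ((t - a) * (t - b) + (t - e) * (a - 1) + (t - d) * (e - 1) + d * (t - g))
        + b * (t - c) * (1 + t - b)) := by
  simp only [ha, hb, hc, hd, he, hg, cfun]
  field_simp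
  ring

theorem cfun_rel_G2_dual' (hX : 1 - X ≠ 0) (hY : 1 - Y ≠ 0) (hXY : 1 - X * Y ≠ 0)
    (ha : a = cfun t X) (hb : b = cfun t Y) (hc : c = cfun t (X * Y ^ 3))
    (hd : d = cfun t (X ^ 2 * Y ^ 3)) (he : e = cfun t (X * Y)) (hg : g = cfun t (X * Y ^ 2))
    (h₁ : 1 - X * Y ^ 2 ≠ 0) (h₂ : 1 - X * Y ^ 3 ≠ 0) (h₃ : 1 - X ^ 2 * Y ^ 3 ≠ 0) :
    (t - e) * ((a - 1) * ((t - e) * (a - 1) + (t - d) * (e - 1) + d * (t - g))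
        + (1 + t - a) * (t - b) * a)
      + (t - d) * ((e - 1) * ((t - d) * (e - 1) + d * (t - g)) + (1 + t - e) * (a - 1) * e)
      + d * ((t - g) * ((d - 1) * (t - g) + (1 + t - d) * (e - 1)) + g * (t - c) * (1 + t - g))
      = a * ((t - b) * ((t - a) * (t - b) + (t - e) * (a - 1) + (t - d) * (e - 1) + d * (t - g))
        + b * (t - c) * (1 + t - b)) := by
  simp only [ha, hb, hc, hd, he, hg, cfun]
  field_simp
  ring

end Identities

section Field

variable {ι V N : Type*} [AddCommGroup V] [Module ℝ V] [AddCommGroup N] [Module ℝ N]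
  {Φ : RootPairing ι ℝ V N}

/-! ### The action of the Weyl group on the fraction field of `𝕂[P]` -/

theorem coe_weylMap (w : Φ.weylGroup) (v : weightLattice Φ) :
    (weylMap Φ w v : V) = w • (v : V) := rfl

theorem weylMap_one (v : weightLattice Φ) : weylMap Φ 1 v = v := by
  ext; rw [coe_weylMap, one_smul]

theorem weylMap_mul (w w' : Φ.weylGroup) (v : weightLattice Φ) :
    weylMap Φ (w * w') v = weylMap Φ w (weylMap Φ w' v) := by
  ext; simp only [coe_weylMap, mul_smul]

theorem weylAct_single (w : Φ.weylGroup) (v : weightLattice Φ) (c : GroundRing) :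
    weylAct Φ w (AddMonoidAlgebra.single v c) = AddMonoidAlgebra.single (weylMap Φ w v) c :=
  AddMonoidAlgebra.mapDomain_single

theorem weylAct_xP (w : Φ.weylGroup) (v : weightLattice Φ) :
    weylAct Φ w (xP v) = xP (weylMap Φ w v) := weylAct_single w v 1

theorem weightAlgebra_algHom_ext {A : Type*} [Semiring A] [Algebra GroundRing A]
    {f g : WeightAlgebra Φ →ₐ[GroundRing] A} (h : ∀ v, f (xP v) = g (xP v)) : f = g :=
  AddMonoidAlgebra.algHom_ext h (AlgHom.ext fun c ↦
    (AlgHom.commutes (f.comp _) c).trans (AlgHom.commutes (g.comp _) c).symm)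

theorem weylAct_one : weylAct Φ 1 = AlgHom.id GroundRing (WeightAlgebra Φ) :=
  weightAlgebra_algHom_ext fun v ↦ by rw [weylAct_xP, weylMap_one]; rfl

theorem weylAct_mul (w w' : Φ.weylGroup) :
    weylAct Φ (w * w') = (weylAct Φ w).comp (weylAct Φ w') :=
  weightAlgebra_algHom_ext fun v ↦ by
    rw [weylAct_xP, weylMap_mul, AlgHom.comp_apply, weylAct_xP, weylAct_xP]

theorem weylAct_injective (w : Φ.weylGroup) : Function.Injective (weylAct Φ w) := by
  refine Function.LeftInverse.injective (g := weylAct Φ w⁻¹) fun f ↦ ?_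
  rw [← AlgHom.comp_apply, ← weylAct_mul, inv_mul_cancel, weylAct_one, AlgHom.id_apply]

/-- P sits in a rational vector space; unique sums make 𝕂[P] a domain, so that it has a fraction
field. -/
instance twoUniqueSums_weightLattice : TwoUniqueSums (weightLattice Φ) := by
  let : Module ℚ V := Module.compHom V (algebraMap ℚ ℝ)
  exact TwoUniqueSums.of_injective_addHom
    ((weightLattice Φ).subtype : weightLattice Φ →ₙ+ V) Subtype.val_injective inferInstance

instance isDomain_weightAlgebra : IsDomain (WeightAlgebra Φ) := inferInstance

variable (Φ) in
/-- The fraction field of `𝕂[P]`. -/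
abbrev WeightField : Type _ := FractionRing (WeightAlgebra Φ)

/-- The action of `w ∈ W` on the fraction field of `𝕂[P]`. -/
def actF (w : Φ.weylGroup) : WeightField Φ →+* WeightField Φ :=
  IsFractionRing.map (j := (weylAct Φ w).toRingHom) (weylAct_injective w)

theorem actF_algebraMap (w : Φ.weylGroup) (f : WeightAlgebra Φ) :
    actF w (algebraMap _ (WeightField Φ) f) = algebraMap _ _ (weylAct Φ w f) :=
  IsLocalization.map_eq (S := WeightField Φ) (Q := WeightField Φ)
    (nonZeroDivisors_le_comap_nonZeroDivisors_of_injective _ (weylAct_injective w)) f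

theorem actF_one (f : WeightField Φ) : actF 1 f = f := by
  have : actF (1 : Φ.weylGroup) = RingHom.id _ :=
    IsLocalization.ringHom_ext (nonZeroDivisors (WeightAlgebra Φ)) (RingHom.ext fun f ↦ by
      rw [RingHom.comp_apply, actF_algebraMap, weylAct_one]; rfl)
  rw [this, RingHom.id_apply]

theorem actF_mul (w w' : Φ.weylGroup) (f : WeightField Φ) :
    actF (w * w') f = actF w (actF w' f) := by
  have : actF (w * w') = (actF w).comp (actF w') :=
    IsLocalization.ringHom_ext (nonZeroDivisors (WeightAlgebra Φ)) (RingHom.ext fun f ↦ by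
      simp only [RingHom.comp_apply, actF_algebraMap, weylAct_mul, AlgHom.comp_apply])
  rw [this, RingHom.comp_apply]

theorem actF_algebraMap_ground (w : Φ.weylGroup) (c : GroundRing) :
    actF w (algebraMap GroundRing (WeightField Φ) c) = algebraMap GroundRing _ c := by
  rw [IsScalarTower.algebraMap_apply GroundRing (WeightAlgebra Φ), actF_algebraMap,
    AlgHom.commutes]

/-- The element `x^v` of the fraction field. -/
def xF (v : weightLattice Φ) : WeightField Φ := algebraMap (WeightAlgebra Φ) _ (xP v)

theorem xP_add (v v' : weightLattice Φ) : xP (v + v') = xP v * xP v' := by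
  simp [xP, AddMonoidAlgebra.single_mul_single]

theorem xP_injective : Function.Injective (xP : weightLattice Φ → WeightAlgebra Φ) := by
  intro v v' h
  exact AddMonoidAlgebra.single_left_injective one_ne_zero h

theorem xF_add (v v' : weightLattice Φ) : xF (v + v') = xF v * xF v' := by
  rw [xF, xP_add, map_mul]; rfl

theorem xF_zero : xF (0 : weightLattice Φ) = 1 := map_one (algebraMap (WeightAlgebra Φ) _)

theorem xF_injective : Function.Injective (xF : weightLattice Φ → WeightField Φ) :=
  (IsFractionRing.injective _ _).comp xP_injective

theorem xF_neg (v : weightLattice Φ) : xF (-v) = (xF v)⁻¹ := by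
  refine eq_inv_of_mul_eq_one_left ?_
  rw [← xF_add, neg_add_cancel, xF_zero]

theorem xF_ne_zero (v : weightLattice Φ) : xF v ≠ 0 := by
  intro h
  have := xF_add v (-v)
  rw [h, zero_mul, add_neg_cancel, xF_zero] at this
  exact one_ne_zero this

theorem one_sub_xF_ne_zero {v : weightLattice Φ} (h : v ≠ 0) : 1 - xF v ≠ 0 := by
  rw [sub_ne_zero, ← xF_zero]
  exact fun h' ↦ h (xF_injective h').symm

theorem actF_xF (w : Φ.weylGroup) (v : weightLattice Φ) :
    actF w (xF v) = xF (weylMap Φ w v) := by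
  rw [xF, actF_algebraMap, weylAct_xP]; rfl

/-- The element `q` of the fraction field. -/
def qF : WeightField Φ := algebraMap GroundRing _ (LaurentPolynomial.T 1)

theorem qF_mul : (qF : WeightField Φ) * algebraMap GroundRing _ (LaurentPolynomial.T (-1)) = 1 := by
  rw [qF, ← map_mul, ← LaurentPolynomial.T_add]
  simp

theorem qF_ne_zero : (qF : WeightField Φ) ≠ 0 := left_ne_zero_of_mul_eq_one qF_mul

theorem qF_inv : (qF : WeightField Φ)⁻¹ = algebraMap GroundRing _ (LaurentPolynomial.T (-1)) :=
  inv_eq_of_mul_eq_one_right qF_mul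

theorem algebraMap_qSub : algebraMap GroundRing (WeightField Φ) qSub = qF - qF⁻¹ := by
  rw [qSub, map_sub, qF_inv, qF]

theorem actF_qF (w : Φ.weylGroup) : actF w qF = qF := actF_algebraMap_ground w _

/-- 1 and q² x^v are monomials with different exponents. This makes the numerator of c nonzero. -/
theorem one_sub_qF_sq_mul_xF_ne_zero {v : weightLattice Φ} (h : v ≠ 0) :
    1 - qF ^ 2 * xF v ≠ 0 := by
  have e : qF ^ 2 * xF v = algebraMap (WeightAlgebra Φ) (WeightField Φ)
      (AddMonoidAlgebra.single v (LaurentPolynomial.T 2)) := by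
    rw [qF, ← map_pow, xF, IsScalarTower.algebraMap_apply GroundRing (WeightAlgebra Φ), ← map_mul,
      ← Algebra.smul_def, LaurentPolynomial.T_pow, xP, AddMonoidAlgebra.smul_single, smul_eq_mul,
      mul_one]
    rfl
  rw [e, sub_ne_zero, ← map_one (algebraMap (WeightAlgebra Φ) (WeightField Φ))]
  intro h'
  have h'' := congrArg AddMonoidAlgebra.coeff (IsFractionRing.injective _ _ h')
  rw [AddMonoidAlgebra.one_def, AddMonoidAlgebra.coeff_single, AddMonoidAlgebra.coeff_single,
    Finsupp.single_eq_single_iff] at h''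
  rcases h'' with h'' | h''
  · exact h h''.1.symm
  · exact one_ne_zero h''.1

/-- The element `(1 - q² x^{-v}) / (1 - x^{-v})` of the fraction field. -/
def cF (v : weightLattice Φ) : WeightField Φ := cfun (qF ^ 2) (xF (-v))

theorem actF_cF (w : Φ.weylGroup) (v : weightLattice Φ) : actF w (cF v) = cF (weylMap Φ w v) := by
  rw [cF, map_cfun _ (by rw [map_pow, actF_qF]), actF_xF, map_neg, cF]

theorem cF_neg {v : weightLattice Φ} (h : v ≠ 0) : cF (-v) = 1 + qF ^ 2 - cF v := by
  rw [cF, xF_neg (-v), cfun_inv (xF_ne_zero _) (one_sub_xF_ne_zero (neg_ne_zero.2 h)), cF]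

theorem cF_ne_zero {v : weightLattice Φ} (h : v ≠ 0) : cF v ≠ 0 :=
  div_ne_zero (one_sub_qF_sq_mul_xF_ne_zero (neg_ne_zero.2 h)) (one_sub_xF_ne_zero (neg_ne_zero.2 h))

variable [Φ.IsCrystallographic]

/-- The Demazure–Lusztig operator `T_i` on the fraction field:
`q T_i f = (q² - c_i) f + c_i s_i(f)`. -/
def demLus (i : ι) : Module.End GroundRing (WeightField Φ) where
  toFun f := qF⁻¹ * dl (qF ^ 2) (cF (rootWeight Φ i)) (actF (s Φ i)) f
  map_add' f g := by simp only [dl, map_add]; ring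
  map_smul' c f := by
    simp only [dl, RingHom.id_apply, Algebra.smul_def, map_mul, actF_algebraMap_ground]; ring

theorem demLus_apply (i : ι) (f : WeightField Φ) : demLus i f =
    qF⁻¹ * dl (qF ^ 2) (cF (rootWeight Φ i)) (actF (s Φ i)) f := rfl

end Field

/-! ### The braid relation on functions fixed by one simple reflection. -/

section RankTwoOperators

variable {ι V N : Type*} [AddCommGroup V] [Module ℝ V] [AddCommGroup N] [Module ℝ N]
  {Φ : RootPairing ι ℝ V N}

theorem dl_mul_of_fixed {F : Type*} [CommRing F] {t a c : F} {σ : F →+* F} (h : σ c = c) (f : F) :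
    dl t a σ (c * f) = c * dl t a σ f := by
  simp only [dl, map_mul, h]; ring

theorem actF_s_s (i : ι) (f : WeightField Φ) : actF (s Φ i) (actF (s Φ i) f) = f := by
  rw [← actF_mul, s_mul_self, actF_one]

variable [Φ.IsCrystallographic]

theorem weylMap_rootWeight (w : Φ.weylGroup) (j : ι) :
    weylMap Φ w (rootWeight Φ j) = rootWeight Φ (w • j) := by
  ext
  exact (root_smul_index w j).symm

theorem weylMap_s_comb {i j : ι} {p : ℕ}
    (hp : s Φ i • Φ.root j = Φ.root j + (p : ℝ) • Φ.root i) (x y : ℤ) :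
    weylMap Φ (s Φ i) (x • rootWeight Φ i + y • rootWeight Φ j) =
      (p * y - x) • rootWeight Φ i + y • rootWeight Φ j := by
  have hj : weylMap Φ (s Φ i) (rootWeight Φ j) = rootWeight Φ j + (p : ℤ) • rootWeight Φ i := by
    ext
    refine hp.trans ?_
    simp [rootWeight, Nat.cast_smul_eq_nsmul]
  have hi : weylMap Φ (s Φ i) (rootWeight Φ i) = -rootWeight Φ i := by
    rw [weylMap_rootWeight]
    ext
    exact root_s_smul_self i
  rw [map_add, map_zsmul, map_zsmul, hi, hj]
  module

/-- The element `c` attached to the weight `x α_i + y α_j`. -/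
def cF₂ (Φ : RootPairing ι ℝ V N) [Φ.IsCrystallographic] (i j : ι) (x y : ℤ) : WeightField Φ :=
  cF (x • rootWeight Φ i + y • rootWeight Φ j)

theorem actF_cF₂ {i j : ι} {p : ℕ} (hp : s Φ i • Φ.root j = Φ.root j + (p : ℝ) • Φ.root i)
    (x y : ℤ) : actF (s Φ i) (cF₂ Φ i j x y) = cF₂ Φ i j (p * y - x) y := by
  rw [cF₂, actF_cF, weylMap_s_comb hp, cF₂]

theorem actF_cF₂' {i j : ι} {r : ℕ} (hr : s Φ j • Φ.root i = Φ.root i + (r : ℝ) • Φ.root j)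
    (x y : ℤ) : actF (s Φ j) (cF₂ Φ i j x y) = cF₂ Φ i j x (r * x - y) := by
  rw [cF₂, actF_cF, add_comm, weylMap_s_comb hr, add_comm, cF₂]

theorem xF_neg_comb (i j : ι) (x y : ℕ) :
    xF (-((x : ℤ) • rootWeight Φ i + (y : ℤ) • rootWeight Φ j)) =
      xF (-rootWeight Φ i) ^ x * xF (-rootWeight Φ j) ^ y := by
  have h : ∀ (v : weightLattice Φ) (n : ℕ), xF (n • v) = xF v ^ n := by
    intro v n
    induction n with
    | zero => rw [zero_smul, xF_zero, pow_zero]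
    | succ n ih => rw [succ_nsmul, xF_add, ih, pow_succ]
  rw [← h, ← h, ← xF_add]
  congr 1
  simp only [natCast_zsmul]
  module

theorem cF₂_natCast (i j : ι) (x y : ℕ) : cF₂ Φ i j x y =
    cfun (qF ^ 2) (xF (-rootWeight Φ i) ^ x * xF (-rootWeight Φ j) ^ y) := by
  rw [cF₂, cF, xF_neg_comb]

variable {b : Φ.Base}

theorem comb_ne_zero [Φ.IsRootSystem] {i j : b.support} (hij : i ≠ j) {x y : ℤ} (h : x ≠ 0 ∨ y ≠ 0) :
    x • rootWeight Φ (i : ι) + y • rootWeight Φ (j : ι) ≠ 0 := by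
  intro h0
  have h1 : (0 : V) + (x : ℝ) • Φ.root i + (y : ℝ) • Φ.root j =
      0 + (0 : ℝ) • Φ.root i + (0 : ℝ) • Φ.root j := by
    have := congrArg (Subtype.val) h0
    simp only [rootWeight, AddSubgroup.coe_add, AddSubgroup.coe_zsmul, ZeroMemClass.coe_zero] at this
    rw [Int.cast_smul_eq_zsmul, Int.cast_smul_eq_zsmul, zero_add, this]
    module
  obtain ⟨h2, h3⟩ := comb_inj hij h1
  rcases h with h | h
  · exact h (by exact_mod_cast h2)
  · exact h (by exact_mod_cast h3)

variable [Φ.IsRootSystem]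

theorem cF₂_neg {i j : b.support} (hij : i ≠ j) {x y : ℤ} (h : x ≠ 0 ∨ y ≠ 0) :
    cF₂ Φ (i : ι) j (-x) (-y) = 1 + qF ^ 2 - cF₂ Φ (i : ι) j x y := by
  rw [cF₂, cF₂, ← cF_neg (comb_ne_zero hij h)]
  congr 1
  module

theorem one_sub_pow_mul_pow_ne_zero {i j : b.support} (hij : i ≠ j) (x y : ℕ)
    (h : x ≠ 0 ∨ y ≠ 0) :
    1 - xF (-rootWeight Φ (i : ι)) ^ x * xF (-rootWeight Φ (j : ι)) ^ y ≠ 0 := by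
  rw [← xF_neg_comb]
  exact one_sub_xF_ne_zero (neg_ne_zero.2 (comb_ne_zero hij (by simpa using h)))

/-- T_i multiplies an s_i-fixed function by q. Thus the word ending in T_i is q times the word of m
- 1 letters ending in T_j, applied to f. The other word is one more operator applied to that same
vector, and it too acts by q because the vector is fixed by its reflection. -/
theorem altProd_demLus_apply_of_fixed [Finite ι] [Φ.IsReduced] {i j : b.support} (hij : i ≠ j)
    {f : WeightField Φ} (hf : actF (s Φ (i : ι)) f = f) :
    altProd (demLus (Φ := Φ) (i : ι)) (demLus (j : ι)) (coxeterExponent b i j) f =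
      altProd (demLus (j : ι)) (demLus (i : ι)) (coxeterExponent b i j) f := by
  obtain ⟨m, p, r, h, hp, hr⟩ := exists_rankTwo hij
  have hm := coxeterExponent_eq hij h hp hr
  have halt : altProd (s Φ (i : ι)) (s Φ (j : ι)) m = altProd (s Φ (j : ι)) (s Φ (i : ι)) m :=
    altProd_s_eq (hm ▸ pow_orderOf_eq_one _)
  -- The dihedral relation applied to f, with s_i f = f cancelled, says that the last point of the
  -- orbit of f is fixed by a reflection.
  replace halt := congrArg (actF · f) halt
  rw [hm]
  have hσ := actF_cF₂ (Φ := Φ) hp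
  have hτ := actF_cF₂' (Φ := Φ) hr
  have hneg := fun x y ↦ cF₂_neg (Φ := Φ) hij (x := x) (y := y)
  have hne := one_sub_pow_mul_pow_ne_zero (Φ := Φ) hij
  have hc := cF₂_natCast (Φ := Φ) (i : ι) (j : ι)
  have ha : cF (rootWeight Φ (i : ι)) = cF₂ Φ (i : ι) j 1 0 := by simp [cF₂]
  have hb : cF (rootWeight Φ (j : ι)) = cF₂ Φ (i : ι) j 0 1 := by simp [cF₂]
  have hσt : actF (s Φ (i : ι)) (qF ^ 2) = qF ^ 2 := by rw [map_pow, actF_qF]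
  have hτt : actF (s Φ (j : ι)) (qF ^ 2) = qF ^ 2 := by rw [map_pow, actF_qF]
  have hσq : actF (s Φ (i : ι)) qF⁻¹ = qF⁻¹ := by rw [map_inv₀, actF_qF]
  have hτq : actF (s Φ (j : ι)) qF⁻¹ = qF⁻¹ := by rw [map_inv₀, actF_qF]
  have hss := actF_s_s (Φ := Φ)
  have hX := hne 1 0 (by simp)
  have hY := hne 0 1 (by simp)
  have hcX := hc 1 0
  have hcY := hc 0 1
  generalize xF (-rootWeight Φ (i : ι)) = X at *
  generalize xF (-rootWeight Φ (j : ι)) = Y at *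
  simp only [pow_one, pow_zero, mul_one, one_mul, Nat.cast_one, Nat.cast_zero] at hX hY hcX hcY
  cases h with
  | A1A1 =>
    have key : actF (s Φ (i : ι)) (dl (qF ^ 2) (cF₂ Φ (i : ι) j 0 1) (actF (s Φ (j : ι))) f) =
        dl (qF ^ 2) (cF₂ Φ (i : ι) j 0 1) (actF (s Φ (j : ι))) f := by
      simp only [altProd, mul_one, actF_mul, hf] at halt
      simp only [dl, map_add, map_mul, map_sub, hσt, hf, halt, hσ]
      norm_num
    simp only [altProd, mul_one, Module.End.mul_apply, demLus_apply, ha, hb, dl_mul_of_fixed hσq,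
      dl_mul_of_fixed hτq, dl_mul_of_fixed hτt, dl_eq_of_fixed hf,
      dl_eq_of_fixed key]
  | A2 =>
    simp only [altProd, mul_one, actF_mul, hf] at halt
    have key := fixed_A2 (σ := actF (s Φ (i : ι))) (τ := actF (s Φ (j : ι))) (t := qF ^ 2)
      (a := cF₂ Φ (i : ι) j 1 0) (b := cF₂ Φ (i : ι) j 0 1) (c := cF₂ Φ (i : ι) j 1 1) hσt hτt
      (by rw [hσ]; norm_num) (by rw [hτ]; norm_num)
      (by rw [hτ, ← hneg _ _ (by norm_num)]; norm_num) (by rw [hτ]; norm_num)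
      (cfun_rel_A2 hX hY (by simpa using hne 1 1) hcX hcY (by simpa using hc 1 1))
      hf rfl rfl (hss _ _) halt.symm
    simp only [altProd, mul_one, Module.End.mul_apply, demLus_apply, ha, hb, dl_mul_of_fixed hσq,
      dl_mul_of_fixed hτq, dl_mul_of_fixed hσt, dl_mul_of_fixed hτt, dl_eq_of_fixed hf,
      dl_eq_of_fixed key]
  | B2 =>
    simp only [altProd, mul_one, actF_mul, hf] at halt
    have key := fixed_B2 (σ := actF (s Φ (i : ι))) (τ := actF (s Φ (j : ι))) (t := qF ^ 2)
      (a := cF₂ Φ (i : ι) j 1 0) (b := cF₂ Φ (i : ι) j 0 1) (c := cF₂ Φ (i : ι) j 1 1)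
      (d := cF₂ Φ (i : ι) j 2 1) hσt hτt
      (by rw [hσ, ← hneg _ _ (by norm_num)]; norm_num) (by rw [hσ]; norm_num)
      (by rw [hσ]; norm_num) (by rw [hσ]; norm_num) (by rw [hτ]; norm_num)
      (by rw [hτ, ← hneg _ _ (by norm_num)]; norm_num) (by rw [hτ]; norm_num)
      (cfun_rel_B2 hX hY (by simpa using hne 1 1) (by simpa using hne 2 1) hcX hcY
        (by simpa using hc 1 1) (by simpa using hc 2 1))
      hf rfl rfl rfl (hss _ _) (hss _ _) halt
    simp only [altProd, mul_one, Module.End.mul_apply, demLus_apply, ha, hb, dl_mul_of_fixed hσq,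
      dl_mul_of_fixed hτq, dl_mul_of_fixed hσt, dl_mul_of_fixed hτt, dl_eq_of_fixed hf,
      dl_eq_of_fixed key]
  | C2 =>
    simp only [altProd, mul_one, actF_mul, hf] at halt
    have key := fixed_B2 (σ := actF (s Φ (i : ι))) (τ := actF (s Φ (j : ι))) (t := qF ^ 2)
      (a := cF₂ Φ (i : ι) j 1 0) (b := cF₂ Φ (i : ι) j 0 1) (c := cF₂ Φ (i : ι) j 1 2)
      (d := cF₂ Φ (i : ι) j 1 1) hσt hτt
      (by rw [hσ, ← hneg _ _ (by norm_num)]; norm_num) (by rw [hσ]; norm_num)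
      (by rw [hσ]; norm_num) (by rw [hσ]; norm_num) (by rw [hτ]; norm_num)
      (by rw [hτ, ← hneg _ _ (by norm_num)]; norm_num) (by rw [hτ]; norm_num)
      (cfun_rel_B2_dual hX hY (by simpa using hne 1 1) (by simpa using hne 1 2) hcX hcY
        (by simpa using hc 1 2) (by simpa using hc 1 1))
      hf rfl rfl rfl (hss _ _) (hss _ _) halt
    simp only [altProd, mul_one, Module.End.mul_apply, demLus_apply, ha, hb, dl_mul_of_fixed hσq,
      dl_mul_of_fixed hτq, dl_mul_of_fixed hσt, dl_mul_of_fixed hτt, dl_eq_of_fixed hf,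
      dl_eq_of_fixed key]
  | G2 =>
    simp only [altProd, mul_one, actF_mul, hf] at halt
    have h11 : 1 - X * Y ≠ 0 := by simpa using hne 1 1
    have h21 : 1 - X ^ 2 * Y ≠ 0 := by simpa using hne 2 1
    have h31 : 1 - X ^ 3 * Y ≠ 0 := by simpa using hne 3 1
    have h32 : 1 - X ^ 3 * Y ^ 2 ≠ 0 := by simpa using hne 3 2
    have c11 : cF₂ Φ (i : ι) j 1 1 = cfun (qF ^ 2) (X * Y) := by simpa using hc 1 1
    have c21 : cF₂ Φ (i : ι) j 2 1 = cfun (qF ^ 2) (X ^ 2 * Y) := by simpa using hc 2 1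
    have c31 : cF₂ Φ (i : ι) j 3 1 = cfun (qF ^ 2) (X ^ 3 * Y) := by simpa using hc 3 1
    have c32 : cF₂ Φ (i : ι) j 3 2 = cfun (qF ^ 2) (X ^ 3 * Y ^ 2) := by simpa using hc 3 2
    have key := fixed_G2 (σ := actF (s Φ (i : ι))) (τ := actF (s Φ (j : ι))) (t := qF ^ 2)
      (a := cF₂ Φ (i : ι) j 1 0) (b := cF₂ Φ (i : ι) j 0 1) (c := cF₂ Φ (i : ι) j 1 1)
      (d := cF₂ Φ (i : ι) j 2 1) (e := cF₂ Φ (i : ι) j 3 1) (g := cF₂ Φ (i : ι) j 3 2) hσt hτt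
      (by rw [hσ, ← hneg _ _ (by norm_num)]; norm_num) (by rw [hσ]; norm_num)
      (by rw [hσ]; norm_num) (by rw [hσ]; norm_num) (by rw [hσ]; norm_num) (by rw [hσ]; norm_num)
      (by rw [hτ]; norm_num) (by rw [hτ, ← hneg _ _ (by norm_num)]; norm_num)
      (by rw [hτ]; norm_num) (by rw [hτ]; norm_num) (by rw [hτ]; norm_num) (by rw [hτ]; norm_num)
      (cfun_rel_G2 hX hY h11 hcX hcY c11 c21 c31 c32 h21 h31 h32)
      (cfun_rel_G2' hX hY h11 hcX hcY c11 c21 c31 c32 h21 h31 h32)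
      hf rfl rfl rfl rfl rfl (hss _ _) (hss _ _) (hss _ _) (hss _ _) halt
    simp only [altProd, mul_one, Module.End.mul_apply, demLus_apply, ha, hb, dl_mul_of_fixed hσq,
      dl_mul_of_fixed hτq, dl_mul_of_fixed hσt, dl_mul_of_fixed hτt, dl_eq_of_fixed hf,
      dl_eq_of_fixed key]
  | G2' =>
    simp only [altProd, mul_one, actF_mul, hf] at halt
    have h11 : 1 - X * Y ≠ 0 := by simpa using hne 1 1
    have h12 : 1 - X * Y ^ 2 ≠ 0 := by simpa using hne 1 2
    have h13 : 1 - X * Y ^ 3 ≠ 0 := by simpa using hne 1 3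
    have h23 : 1 - X ^ 2 * Y ^ 3 ≠ 0 := by simpa using hne 2 3
    have c11 : cF₂ Φ (i : ι) j 1 1 = cfun (qF ^ 2) (X * Y) := by simpa using hc 1 1
    have c12 : cF₂ Φ (i : ι) j 1 2 = cfun (qF ^ 2) (X * Y ^ 2) := by simpa using hc 1 2
    have c13 : cF₂ Φ (i : ι) j 1 3 = cfun (qF ^ 2) (X * Y ^ 3) := by simpa using hc 1 3
    have c23 : cF₂ Φ (i : ι) j 2 3 = cfun (qF ^ 2) (X ^ 2 * Y ^ 3) := by simpa using hc 2 3
    have key := fixed_G2 (σ := actF (s Φ (i : ι))) (τ := actF (s Φ (j : ι))) (t := qF ^ 2)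
      (a := cF₂ Φ (i : ι) j 1 0) (b := cF₂ Φ (i : ι) j 0 1) (c := cF₂ Φ (i : ι) j 1 3)
      (d := cF₂ Φ (i : ι) j 2 3) (e := cF₂ Φ (i : ι) j 1 1) (g := cF₂ Φ (i : ι) j 1 2) hσt hτt
      (by rw [hσ, ← hneg _ _ (by norm_num)]; norm_num) (by rw [hσ]; norm_num)
      (by rw [hσ]; norm_num) (by rw [hσ]; norm_num) (by rw [hσ]; norm_num) (by rw [hσ]; norm_num)
      (by rw [hτ]; norm_num) (by rw [hτ, ← hneg _ _ (by norm_num)]; norm_num)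
      (by rw [hτ]; norm_num) (by rw [hτ]; norm_num) (by rw [hτ]; norm_num) (by rw [hτ]; norm_num)
      (cfun_rel_G2_dual hX hY h11 hcX hcY c13 c23 c11 c12 h12 h13 h23)
      (cfun_rel_G2_dual' hX hY h11 hcX hcY c13 c23 c11 c12 h12 h13 h23)
      hf rfl rfl rfl rfl rfl (hss _ _) (hss _ _) (hss _ _) (hss _ _) halt
    simp only [altProd, mul_one, Module.End.mul_apply, demLus_apply, ha, hb, dl_mul_of_fixed hσq,
      dl_mul_of_fixed hτq, dl_mul_of_fixed hσt, dl_mul_of_fixed hτt, dl_eq_of_fixed hf,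
      dl_eq_of_fixed key]

end RankTwoOperators

/-! ### Expansion of operator words over W, and the braid relations. -/

section Braid

variable {ι V N : Type*} [AddCommGroup V] [Module ℝ V] [AddCommGroup N] [Module ℝ N]
  {Φ : RootPairing ι ℝ V N} [Φ.IsCrystallographic] (b : Φ.Base)

/-- The product of the elements `c` over the inversions of `w`. -/
def cInv (w : Φ.weylGroup) : WeightField Φ := ∏ᶠ j ∈ invSet b w, cF (rootWeight Φ j)

theorem cInv_one : cInv b (1 : Φ.weylGroup) = 1 := by simp [cInv]

theorem rootWeight_ne_zero (j : ι) : rootWeight Φ j ≠ 0 :=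
  fun h ↦ Φ.ne_zero j (congrArg Subtype.val h)

theorem cInv_ne_zero (w : Φ.weylGroup) : cInv b w ≠ 0 := by
  refine finprod_mem_induction (· ≠ 0) one_ne_zero (fun _ _ ↦ mul_ne_zero) fun j _ ↦ ?_
  exact cF_ne_zero (rootWeight_ne_zero j)

variable [Φ.IsRootSystem]

/-! ### Operators as combinations of Weyl group elements -/

theorem eq_of_weylMap_eq {w w' : Φ.weylGroup}
    (h : ∀ v, weylMap Φ w v = weylMap Φ w' v) : w = w' :=
  weyl_ext_root fun j ↦ congrArg Subtype.val (h (rootWeight Φ j))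

theorem actF_injective : Function.Injective
    fun w : Φ.weylGroup ↦ (actF w : WeightField Φ →+* WeightField Φ).toMonoidHom := by
  refine fun w w' h ↦ eq_of_weylMap_eq fun v ↦ xF_injective ?_
  rw [← actF_xF, ← actF_xF]
  exact DFunLike.congr_fun h (xF v)

variable [Finite ι]

instance fintype_weylGroup : Fintype Φ.weylGroup := Fintype.ofFinite _

/-- Dedekind's independence of characters, for the distinct field endomorphisms given by W. -/
theorem eq_zero_of_sum_actF {g : Φ.weylGroup → WeightField Φ}
    (h : ∀ f, ∑ w, g w * actF w f = 0) (w : Φ.weylGroup) : g w = 0 := by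
  have hli := (linearIndependent_monoidHom (WeightField Φ) (WeightField Φ)).comp _
    (actF_injective (Φ := Φ))
  refine Fintype.linearIndependent_iff.1 hli g ?_ w
  funext f
  rw [Finset.sum_apply]
  exact h f

theorem sum_actF_mul_right (g : Φ.weylGroup → WeightField Φ) (u : Φ.weylGroup)
    (f : WeightField Φ) :
    ∑ w, g w * actF w (actF u f) = ∑ w, g (w * u⁻¹) * actF w f := by
  rw [← Equiv.sum_comp (Equiv.mulRight u) fun w ↦ g (w * u⁻¹) * actF w f]
  simp [actF_mul]

variable [Φ.IsReduced]

theorem cInv_s_mul {i : b.support} {w : Φ.weylGroup} (h : b.IsPos (w⁻¹ • (i : ι))) :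
    cInv b (s Φ (i : ι) * w) =
      cF (rootWeight Φ (i : ι)) * actF (s Φ (i : ι)) (cInv b w) := by
  rw [cInv, invSet_s_mul b h, finprod_mem_insert _ (notMem_image_invSet b i w) (Set.toFinite _),
    finprod_mem_image (MulAction.injective (s Φ (i : ι))).injOn, cInv]
  congr 1
  have := (actF (s Φ (i : ι))).toMonoidHom.map_finprod_mem (fun j ↦ cF (rootWeight Φ j))
    (Set.toFinite (invSet b w))
  refine Eq.trans ?_ this.symm
  refine finprod_mem_congr rfl fun j _ ↦ ?_
  change _ = actF (s Φ (i : ι)) _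
  rw [actF_cF, weylMap_rootWeight]

/-- A word in the Demazure–Lusztig operators, as a combination of Weyl group elements. -/
theorem exists_coeff (L : List b.support) : ∃ g : Φ.weylGroup → WeightField Φ,
    (∀ f, (L.map fun i : b.support ↦ demLus (Φ := Φ) (i : ι)).prod f = ∑ w, g w * actF w f) ∧
    (∀ H : Subgroup Φ.weylGroup, (∀ i ∈ L, s Φ (i : ι) ∈ H) → ∀ w, g w ≠ 0 → w ∈ H) ∧
    (∀ w, g w ≠ 0 → len b w < L.length ∨ w = wprod L) ∧
    (len b (wprod L) = L.length → g (wprod L) = qF⁻¹ ^ L.length * cInv b (wprod L)) := by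
  classical
  induction L with
  | nil =>
    refine ⟨Pi.single 1 1, fun f ↦ ?_, fun H _ w hw ↦ ?_, fun w hw ↦ ?_, fun _ ↦ ?_⟩
    · rw [Finset.sum_eq_single 1 (fun w _ hw ↦ by simp [hw]) (by simp)]
      simp [actF_one]
    · by_cases h : w = 1
      · exact h ▸ one_mem H
      · simp [h] at hw
    · by_cases h : w = 1
      · exact Or.inr h
      · simp [h] at hw
    · simp [cInv_one]
  | cons i L ih =>
    obtain ⟨g, hg, hH, hlen, htop⟩ := ih
    -- Coefficients of T_i composed with ∑ g_w w: s_i acts on the coefficient g_w as it moves past,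
    -- and the sum is reindexed by w ↦ s_i w.
    refine ⟨fun w ↦ qF⁻¹ * ((qF ^ 2 - cF (rootWeight Φ (i : ι))) * g w +
      cF (rootWeight Φ (i : ι)) * actF (s Φ (i : ι)) (g (s Φ (i : ι) * w))), fun f ↦ ?_,
      fun H hLH w hw ↦ ?_, fun w hw ↦ ?_, fun hred ↦ ?_⟩
    · rw [List.map_cons, List.prod_cons, Module.End.mul_apply, hg, demLus_apply, dl, map_sum]
      have : ∑ w, actF (s Φ (i : ι)) (g w * actF w f) =
          ∑ w, actF (s Φ (i : ι)) (g (s Φ (i : ι) * w)) * actF w f := by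
        rw [← Equiv.sum_comp (Equiv.mulLeft (s Φ (i : ι)))]
        simp only [Equiv.coe_mulLeft, map_mul, ← actF_mul, s_mul_cancel]
      rw [this, Finset.mul_sum, Finset.mul_sum, ← Finset.sum_add_distrib, Finset.mul_sum]
      exact Finset.sum_congr rfl fun w _ ↦ by ring
    · have hi : s Φ (i : ι) ∈ H := hLH i (by simp)
      have hH' := hH H fun k hk ↦ hLH k (by simp [hk])
      by_cases h : g w = 0
      · have h' : g (s Φ (i : ι) * w) ≠ 0 := fun h' ↦ hw (by simp [h, h'])
        exact (H.mul_mem_cancel_left hi).1 (hH' _ h')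
      · exact hH' w h
    · rw [List.length_cons]
      have hle := len_wprod_le b L
      by_cases h : g w = 0
      · have h' : g (s Φ (i : ι) * w) ≠ 0 := fun h' ↦ hw (by simp [h, h'])
        rcases hlen _ h' with h' | h'
        · left
          have := len_s_mul_le b i (s Φ (i : ι) * w)
          rw [s_mul_cancel] at this
          omega
        · right
          rw [wprod_cons, ← h', s_mul_cancel]
      · left
        rcases hlen w h with h' | rfl <;> omega
    · have hL := len_wprod_tail hred
      have hpos : b.IsPos ((wprod L)⁻¹ • (i : ι)) := by
        by_contra hneg
        have := len_s_mul_of_not_isPos b hneg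
        rw [wprod_cons, List.length_cons] at hred
        omega
      -- The full product is too long to occur in the expansion of the tail, so only the s_i part of
      -- T_i contributes to the top coefficient.
      have h0 : g (wprod (i :: L)) = 0 := by
        by_contra h
        rw [List.length_cons] at hred
        rcases hlen _ h with h' | h'
        · omega
        · rw [h'] at hred
          omega
      beta_reduce
      rw [h0, wprod_cons, s_mul_cancel, htop hL, cInv_s_mul b hpos, List.length_cons, map_mul,
        map_pow, map_inv₀, actF_qF]
      ring

variable {b}

/-- The Demazure–Lusztig operators satisfy the braid relations. -/
theorem altProd_demLus {i j : b.support} (hij : i ≠ j) :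
    altProd (demLus (Φ := Φ) (i : ι)) (demLus (j : ι)) (coxeterExponent b i j) =
      altProd (demLus (j : ι)) (demLus (i : ι)) (coxeterExponent b i j) := by
  obtain ⟨g, hg, hH, -, htop⟩ := exists_coeff b (altList i j (coxeterExponent b i j))
  obtain ⟨g', hg', hH', -, htop'⟩ := exists_coeff b (altList j i (coxeterExponent b i j))
  rw [prod_map_altList] at hg hg'
  have hcomm : coxeterExponent b j i = coxeterExponent b i j := by
    rw [coxeterExponent, coxeterExponent, ← orderOf_inv, mul_inv_rev, s_inv, s_inv]
  have halt : altProd (s Φ (i : ι)) (s Φ (j : ι)) (coxeterExponent b i j) =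
      altProd (s Φ (j : ι)) (s Φ (i : ι)) (coxeterExponent b i j) :=
    altProd_s_eq (pow_orderOf_eq_one _)
  rw [wprod_altList, length_altList] at htop htop'
  -- At the longest element both words are reduced, and the top coefficient depends only on that
  -- element and its length.
  have h0 : g (altProd (s Φ (i : ι)) (s Φ (j : ι)) (coxeterExponent b i j)) -
      g' (altProd (s Φ (i : ι)) (s Φ (j : ι)) (coxeterExponent b i j)) = 0 := by
    rw [htop (len_altProd hij le_rfl), halt, htop' (len_altProd hij.symm hcomm.ge), sub_self]
  have anti : ∀ k : ι, (∀ f : WeightField Φ, actF (s Φ k) f = f →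
      altProd (demLus (Φ := Φ) (i : ι)) (demLus (j : ι)) (coxeterExponent b i j) f =
        altProd (demLus (j : ι)) (demLus (i : ι)) (coxeterExponent b i j) f) →
      ∀ w, g (w * s Φ k) - g' (w * s Φ k) = -(g w - g' w) := by
    intro k hk w
    rw [eq_neg_iff_add_eq_zero]
    refine eq_zero_of_sum_actF (g := fun w ↦ g (w * s Φ k) - g' (w * s Φ k) + (g w - g' w))
      (fun f ↦ ?_) w
    -- The symmetrised function is s_k-fixed, so the difference of the two operators kills it for
    -- every f; independence then gives the sign change.
    have h1 := hk (f + actF (s Φ k) f) (by rw [map_add, actF_s_s, add_comm])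
    rw [hg, hg'] at h1
    simp only [map_add, mul_add, Finset.sum_add_distrib, sum_actF_mul_right, s_inv] at h1
    simp only [add_mul, sub_mul, Finset.sum_add_distrib, Finset.sum_sub_distrib]
    linear_combination h1
  have antii := anti i fun f ↦ altProd_demLus_apply_of_fixed hij
  have antij := anti j fun f hf ↦ by
    have := altProd_demLus_apply_of_fixed hij.symm hf
    rw [hcomm] at this
    exact this.symm
  have hcl : ∀ u ∈ Subgroup.closure {s Φ (i : ι), s Φ (j : ι)}, ∀ w,
      g (w * u) - g' (w * u) = 0 ↔ g w - g' w = 0 := by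
    intro u hu
    induction hu using Subgroup.closure_induction with
    | mem u hu =>
      rcases hu with rfl | rfl
      · intro w; rw [antii, neg_eq_zero]
      · intro w; rw [antij, neg_eq_zero]
    | one => simp
    | mul u u' _ _ h h' => intro w; rw [← mul_assoc, h', h]
    | inv u _ h => intro w; rw [← h (w * u⁻¹), inv_mul_cancel_right]
  have hmem : ∀ k l : b.support, ∀ n, s Φ (k : ι) ∈ Subgroup.closure {s Φ (i : ι), s Φ (j : ι)} →
      s Φ (l : ι) ∈ Subgroup.closure {s Φ (i : ι), s Φ (j : ι)} → ∀ m ∈ altList k l n,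
      s Φ (m : ι) ∈ Subgroup.closure {s Φ (i : ι), s Φ (j : ι)} := by
    intro k l n hk hl
    induction n generalizing k l with
    | zero => simp [altList]
    | succ n ih =>
      intro m hm
      rcases List.mem_cons.1 hm with rfl | hm
      · exact hk
      · exact ih l k hl hk m hm
  have hi : s Φ (i : ι) ∈ Subgroup.closure {s Φ (i : ι), s Φ (j : ι)} :=
    Subgroup.subset_closure (by simp)
  have hj : s Φ (j : ι) ∈ Subgroup.closure {s Φ (i : ι), s Φ (j : ι)} :=
    Subgroup.subset_closure (by simp)
  have haltmem : ∀ n, ∀ k l : ι, s Φ k ∈ Subgroup.closure {s Φ (i : ι), s Φ (j : ι)} →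
      s Φ l ∈ Subgroup.closure {s Φ (i : ι), s Φ (j : ι)} →
      altProd (s Φ k) (s Φ l) n ∈ Subgroup.closure {s Φ (i : ι), s Φ (j : ι)} := by
    intro n
    induction n with
    | zero => intros; exact one_mem _
    | succ n ih => intro k l hk hl; exact mul_mem hk (ih l k hl hk)
  -- All coefficients live on the dihedral subgroup, which right multiplication by s_i and s_j
  -- connects to the longest element.
  have hzero : ∀ w, g w - g' w = 0 := by
    intro w
    by_contra hw
    have hwc : w ∈ Subgroup.closure {s Φ (i : ι), s Φ (j : ι)} := by
      by_cases h : g w = 0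
      · exact hH' _ (hmem j i _ hj hi) w fun h' ↦ hw (by rw [h, h', sub_zero])
      · exact hH _ (hmem i j _ hi hj) w h
    refine hw ((hcl _ (mul_mem (inv_mem (haltmem (coxeterExponent b i j) i j hi hj)) hwc)
      (altProd (s Φ (i : ι)) (s Φ (j : ι)) (coxeterExponent b i j))).2 h0 ▸ ?_)
    rw [mul_inv_cancel_left]
  refine LinearMap.ext fun f ↦ ?_
  rw [hg, hg']
  exact Finset.sum_congr rfl fun w _ ↦ by rw [sub_eq_zero.1 (hzero w)]

end Braid

/-! ### The representation on the fraction field and injectivity of 𝕂[P] → H̃. -/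

section Representation

variable {ι V N : Type*} [AddCommGroup V] [Module ℝ V] [AddCommGroup N] [Module ℝ N]
  {Φ : RootPairing ι ℝ V N} (b : Φ.Base)

theorem map_altProd {A B F : Type*} [Monoid A] [Monoid B] [FunLike F A B] [MonoidHomClass F A B]
    (f : F) (a c : A) (n : ℕ) :
    f (altProd a c n) = altProd (f a) (f c) n := by
  induction n generalizing a c with
  | zero => exact map_one f
  | succ n ih => rw [altProd, map_mul, ih, altProd]

theorem freeLin_add (f g : WeightAlgebra Φ) : freeLin b (f + g) = freeLin b f + freeLin b g :=
  Finsupp.sum_add_index' (fun _ ↦ zero_smul _ _) fun _ _ _ ↦ add_smul _ _ _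

theorem freeLin_single (v : weightLattice Φ) (c : GroundRing) :
    freeLin b (AddMonoidAlgebra.single v c) = c • freeX b v :=
  Finsupp.sum_single_index (zero_smul _ _)

theorem single_eq_smul_xP (v : weightLattice Φ) (c : GroundRing) :
    (AddMonoidAlgebra.single v c : WeightAlgebra Φ) = c • xP v := by
  rw [xP, AddMonoidAlgebra.smul_single, smul_eq_mul, mul_one]

/-- An algebra homomorphism compatible with the generators `x^v` is compatible with the
expressions in them. -/
theorem map_freeLin {A : Type*} [Semiring A] [Algebra GroundRing A]
    (F : Free b →ₐ[GroundRing] A) (G : WeightAlgebra Φ →ₐ[GroundRing] A)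
    (h : ∀ v, F (freeX b v) = G (xP v)) (f : WeightAlgebra Φ) : F (freeLin b f) = G f := by
  induction f using AddMonoidAlgebra.induction_linear with
  | zero => rw [map_zero, freeLin]; simp
  | add f g hf hg => rw [freeLin_add, map_add, map_add, hf, hg]
  | single v c => rw [freeLin_single, map_smul, h, single_eq_smul_xP, map_smul]

/-- Multiplication operators on the fraction field. -/
def mulF : WeightAlgebra Φ →ₐ[GroundRing] Module.End GroundRing (WeightField Φ) :=
  (Algebra.lmul GroundRing (WeightField Φ)).comp
    (IsScalarTower.toAlgHom GroundRing (WeightAlgebra Φ) (WeightField Φ))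

theorem mulF_apply (f : WeightAlgebra Φ) (g : WeightField Φ) :
    mulF f g = algebraMap (WeightAlgebra Φ) (WeightField Φ) f * g := rfl

variable [Φ.IsCrystallographic]

theorem qF_sq_sub_cF (i : ι) : qF ^ 2 - cF (rootWeight Φ i) =
    (qF ^ 2 - 1) / (1 - xF (-rootWeight Φ i)) := by
  have h := one_sub_xF_ne_zero (neg_ne_zero.2 (rootWeight_ne_zero (Φ := Φ) i))
  rw [cF, cfun]
  field_simp
  ring

theorem demLus_sq (i : ι) : demLus (Φ := Φ) i ^ 2 = qSub • demLus i + 1 := by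
  refine LinearMap.ext fun f ↦ ?_
  have hα : weylMap Φ (s Φ i) (rootWeight Φ i) = -rootWeight Φ i := by
    rw [weylMap_rootWeight]
    ext
    exact root_s_smul_self i
  have hc : actF (s Φ i) (cF (rootWeight Φ i)) = 1 + qF ^ 2 - cF (rootWeight Φ i) := by
    rw [actF_cF, hα, cF_neg (rootWeight_ne_zero i)]
  have hq := qF_ne_zero (Φ := Φ)
  rw [pow_two, Module.End.mul_apply, LinearMap.add_apply, LinearMap.smul_apply, Algebra.smul_def,
    algebraMap_qSub]
  simp only [demLus_apply, dl, map_mul, map_add, map_sub, map_pow, map_inv₀, actF_qF, hc,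
    actF_s_s, Module.End.one_apply]
  field_simp
  ring

/-- Since q² - c_i = (q² - 1)/(1 - x^{-α_i}), the Bernstein relation becomes `demazure_mul` divided
by 1 - x^{-α_i}, up to a scalar function. -/
theorem mulF_mul_demLus (i : ι) (v : weightLattice Φ) :
    mulF (xP v) * demLus i =
      demLus i * mulF (xP (weylMap Φ (s Φ i) v)) + qSub • mulF (demazure i v) := by
  refine LinearMap.ext fun f ↦ ?_
  have h := congrArg (algebraMap (WeightAlgebra Φ) (WeightField Φ)) (demazure_mul i v)
  simp only [map_mul, map_sub, map_one] at h
  change _ * (1 - xF _) = xF _ - xF _ at h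
  have hs : weylMap Φ (s Φ i) (weylMap Φ (s Φ i) v) = v := by
    rw [← weylMap_mul, s_mul_self, weylMap_one]
  have hne := one_sub_xF_ne_zero (neg_ne_zero.2 (rootWeight_ne_zero (Φ := Φ) i))
  have hq := qF_ne_zero (Φ := Φ)
  rw [LinearMap.add_apply, LinearMap.smul_apply, Algebra.smul_def, algebraMap_qSub,
    Module.End.mul_apply, Module.End.mul_apply, mulF_apply, mulF_apply, mulF_apply]
  change xF v * _ = demLus i (xF _ * f) + _
  rw [demLus_apply, demLus_apply, dl, dl, map_mul, actF_xF, hs, qF_sq_sub_cF]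
  field_simp
  linear_combination (-(qF ^ 2 - 1) * f) * h

/-- The images of the generators in the representation on the fraction field. -/
def genMap : Generator b → Module.End GroundRing (WeightField Φ)
  | .T i => demLus (i : ι)
  | .x v => mulF (xP v)

theorem lift_freeX (v : weightLattice Φ) :
    FreeAlgebra.lift GroundRing (genMap b) (freeX b v) = mulF (xP v) :=
  FreeAlgebra.lift_ι_apply _ _

theorem lift_freeT (i : b.support) :
    FreeAlgebra.lift GroundRing (genMap b) (freeT b i) = demLus (i : ι) :=
  FreeAlgebra.lift_ι_apply _ _

/-- The element `T_i` of the affine Hecke algebra. -/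
def TH (i : b.support) : HeckeAlgebra b := mk b (freeT b i)

theorem ofWeightAlgebra_xP (v : weightLattice Φ) : ofWeightAlgebra b (xP v) = xH b v := by
  rw [ofWeightAlgebra, xP, AddMonoidAlgebra.lift_single, one_smul]
  rfl

variable [Finite ι] [Φ.IsRootSystem] [Φ.IsReduced]

theorem lift_rel {x y : Free b} (h : Rel b x y) :
    FreeAlgebra.lift GroundRing (genMap b) x = FreeAlgebra.lift GroundRing (genMap b) y := by
  cases h with
  | braid i j hij =>
    rw [map_altProd, map_altProd, lift_freeT, lift_freeT, altProd_demLus hij]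
  | quadratic i =>
    rw [map_pow, map_add, map_smul, lift_freeT, map_one, demLus_sq]
  | x_zero => rw [lift_freeX, map_one]; exact map_one mulF
  | x_add v w => rw [map_mul, lift_freeX, lift_freeX, lift_freeX, ← map_mul, xP_add]
  | bernstein i v =>
    rw [map_mul, map_add, map_mul, map_smul, lift_freeX, lift_freeX, lift_freeT,
      map_freeLin b _ mulF (lift_freeX b), mulF_mul_demLus]

/-- The representation of `H̃` on the fraction field of `𝕂[P]`. -/
def rho : HeckeAlgebra b →ₐ[GroundRing] Module.End GroundRing (WeightField Φ) :=
  RingQuot.liftAlgHom GroundRing ⟨FreeAlgebra.lift GroundRing (genMap b), fun _ _ ↦ lift_rel b⟩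

theorem rho_mk (x : Free b) : rho b (mk b x) = FreeAlgebra.lift GroundRing (genMap b) x :=
  RingQuot.liftAlgHom_mkAlgHom_apply _ _ _ _

theorem rho_TH (i : b.support) : rho b (TH b i) = demLus (i : ι) := by
  rw [TH, rho_mk, lift_freeT]

theorem rho_ofWeightAlgebra (f : WeightAlgebra Φ) : rho b (ofWeightAlgebra b f) = mulF f := by
  have : (rho b).comp (ofWeightAlgebra b) = mulF := weightAlgebra_algHom_ext fun v ↦ by
    rw [AlgHom.comp_apply, ofWeightAlgebra_xP, xH, rho_mk, lift_freeX]
  rw [← this, AlgHom.comp_apply]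

/-- The operator of f sends 1 to f. -/
theorem ofWeightAlgebra_injective : Function.Injective (ofWeightAlgebra b) := by
  intro f g h
  have := congrArg (fun x ↦ rho b x 1) h
  simp only [rho_ofWeightAlgebra, mulF_apply, mul_one] at this
  exact IsFractionRing.injective _ _ this

end Representation

/-! ### Consequences of the relations inside H̃. -/

section Relations

variable {ι V N : Type*} [AddCommGroup V] [Module ℝ V] [AddCommGroup N] [Module ℝ N]
  {Φ : RootPairing ι ℝ V N} [Φ.IsCrystallographic] (b : Φ.Base)

theorem mk_eq_of_rel {x y : Free b} (h : Rel b x y) : mk b x = mk b y :=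
  RingQuot.mkAlgHom_rel GroundRing h

theorem mk_surjective : Function.Surjective (mk b) := RingQuot.mkAlgHom_surjective _ _

theorem TH_mul_self (i : b.support) : TH b i * TH b i = qSub • TH b i + 1 := by
  have := mk_eq_of_rel b (Rel.quadratic i)
  rwa [map_pow, map_add, map_smul, map_one, pow_two] at this

theorem altProd_TH {i j : b.support} (hij : i ≠ j) :
    altProd (TH b i) (TH b j) (coxeterExponent b i j) =
      altProd (TH b j) (TH b i) (coxeterExponent b i j) := by
  have := mk_eq_of_rel b (Rel.braid i j hij)
  rwa [map_altProd, map_altProd] at this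

theorem ofWeightAlgebra_xP_mul_TH (i : b.support) (v : weightLattice Φ) :
    ofWeightAlgebra b (xP v) * TH b i = TH b i * ofWeightAlgebra b (xP (weylMap Φ (s Φ i) v)) +
      qSub • ofWeightAlgebra b (demazure (i : ι) v) := by
  have := mk_eq_of_rel b (Rel.bernstein i v)
  rw [map_mul, map_add, map_mul, map_smul,
    map_freeLin b _ (ofWeightAlgebra b) fun v ↦ (ofWeightAlgebra_xP b v).symm] at this
  rwa [ofWeightAlgebra_xP, ofWeightAlgebra_xP]

/-- Moving `T_i` to the right of an element of `𝕂[P]`. -/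
theorem exists_TH_mul_ofWeightAlgebra (i : b.support) (f : WeightAlgebra Φ) :
    ∃ g : WeightAlgebra Φ, TH b i * ofWeightAlgebra b f =
        ofWeightAlgebra b (weylAct Φ (s Φ i) f) * TH b i + qSub • ofWeightAlgebra b g ∧
      g * (1 - xP (-rootWeight Φ (i : ι))) = f - weylAct Φ (s Φ i) f := by
  induction f using AddMonoidAlgebra.induction_linear with
  | zero => exact ⟨0, by simp, by simp⟩
  | add f f' hf hf' =>
    obtain ⟨g, h, hg⟩ := hf
    obtain ⟨g', h', hg'⟩ := hf'
    refine ⟨g + g', ?_, ?_⟩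
    · rw [map_add, mul_add, h, h', map_add, map_add, map_add, add_mul, smul_add]
      abel
    · rw [add_mul, hg, hg', map_add]
      abel
  | single v c =>
    have hs : weylMap Φ (s Φ i) (weylMap Φ (s Φ i) v) = v := by
      rw [← weylMap_mul, s_mul_self, weylMap_one]
    have hT := ofWeightAlgebra_xP_mul_TH b i (weylMap Φ (s Φ i) v)
    have hd := demazure_mul (i : ι) (weylMap Φ (s Φ i) v)
    rw [hs] at hT hd
    rw [single_eq_smul_xP]
    -- The Bernstein relation is read at s_i v rather than v, which puts T_i x^v on its right-hand
    -- side; hence the sign.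
    refine ⟨c • -demazure (i : ι) (weylMap Φ (s Φ i) v), ?_, ?_⟩
    · rw [map_smul, map_smul, map_smul, map_smul, weylAct_xP, mul_smul_comm, smul_mul_assoc, hT,
        map_neg, smul_comm qSub c, ← smul_add, smul_neg, add_neg_cancel_right]
    · have h : -demazure (i : ι) (weylMap Φ (s Φ i) v) * (1 - xP (-rootWeight Φ (i : ι))) =
          xP v - xP (weylMap Φ (s Φ i) v) := by linear_combination -hd
      rw [map_smul, weylAct_xP, smul_mul_assoc, h, smul_sub]

/-- The correction term g satisfies g(1 - x^{-α_i}) = f - s_i f = 0, and 𝕂[P] is a domain. -/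
theorem TH_commute_of_weylAct_s_eq {i : b.support} {f : WeightAlgebra Φ}
    (h : weylAct Φ (s Φ (i : ι)) f = f) :
    TH b i * ofWeightAlgebra b f = ofWeightAlgebra b f * TH b i := by
  obtain ⟨g, hT, hg⟩ := exists_TH_mul_ofWeightAlgebra b i f
  rw [h, sub_self] at hg
  have hne : (1 : WeightAlgebra Φ) - xP (-rootWeight Φ (i : ι)) ≠ 0 := fun h0 ↦ by
    refine one_sub_xF_ne_zero (neg_ne_zero.2 (rootWeight_ne_zero (Φ := Φ) (i : ι))) ?_
    rw [xF, ← map_one (algebraMap (WeightAlgebra Φ) (WeightField Φ)), ← map_sub, h0, map_zero]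
  rw [hT, h, (mul_eq_zero.1 hg).resolve_right hne, map_zero, smul_zero, add_zero]

theorem mem_invariants_of_simple [Finite ι] [Φ.IsReduced] {f : WeightAlgebra Φ}
    (h : ∀ i : b.support, weylAct Φ (s Φ (i : ι)) f = f) : f ∈ invariants Φ := by
  intro w
  obtain ⟨L, rfl⟩ := exists_wprod_eq b w
  induction L with
  | nil => rw [wprod_nil, weylAct_one, AlgHom.id_apply]
  | cons i L ih => rw [wprod_cons, weylAct_mul, AlgHom.comp_apply, ih, h]

/-- An induction principle: what holds for scalars and the generators and is closed under
sums and products holds in `H̃`. -/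
theorem heckeAlgebra_induction {p : HeckeAlgebra b → Prop}
    (hc : ∀ c : GroundRing, p (algebraMap _ _ c)) (hT : ∀ i, p (TH b i))
    (hx : ∀ f, p (ofWeightAlgebra b f)) (hmul : ∀ y z, p y → p z → p (y * z))
    (hadd : ∀ y z, p y → p z → p (y + z)) (y : HeckeAlgebra b) : p y := by
  obtain ⟨a, rfl⟩ := mk_surjective b y
  induction a using FreeAlgebra.induction with
  | grade0 c => rw [AlgHom.commutes]; exact hc c
  | grade1 x =>
    cases x with
    | T i => exact hT i
    | x v =>
      have := hx (xP v)
      rwa [ofWeightAlgebra_xP] at this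
  | mul y z hy hz => rw [map_mul]; exact hmul _ _ hy hz
  | add y z hy hz => rw [map_add]; exact hadd _ _ hy hz

end Relations

/-! ### The elements T_w and the spanning of H̃ by f_w T_w. -/

section Spanning

variable {ι V N : Type*} [AddCommGroup V] [Module ℝ V] [AddCommGroup N] [Module ℝ N]
  {Φ : RootPairing ι ℝ V N} [Φ.IsCrystallographic] [Finite ι] [Φ.IsRootSystem] [Φ.IsReduced]
  (b : Φ.Base)

/-- A chosen reduced word of `w`. -/
def redWord (w : Φ.weylGroup) : List b.support := (exists_reduced_word b w).choose

theorem wprod_redWord (w : Φ.weylGroup) : wprod (redWord b w) = w :=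
  (exists_reduced_word b w).choose_spec.1

theorem length_redWord (w : Φ.weylGroup) : (redWord b w).length = len b w :=
  (exists_reduced_word b w).choose_spec.2

/-- The element `T_w` of `H̃`. -/
def TW (w : Φ.weylGroup) : HeckeAlgebra b := ((redWord b w).map (TH b)).prod

theorem TW_one : TW b 1 = 1 := by
  have := length_redWord b 1
  rw [len_one, List.length_eq_zero_iff] at this
  rw [TW, this, List.map_nil, List.prod_nil]

/-- Prepending i to a reduced word of w stays reduced here, and the product does not depend on the
reduced word chosen. -/
theorem TH_mul_TW_of_isPos {i : b.support} {w : Φ.weylGroup} (h : b.IsPos (w⁻¹ • (i : ι))) :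
    TH b i * TW b w = TW b (s Φ i * w) := by
  have h1 : wprod (i :: redWord b w) = s Φ i * w := by rw [wprod_cons, wprod_redWord]
  have h2 := prod_map_eq_of_reduced (L := i :: redWord b w) (L' := redWord b (s Φ i * w))
    (fun i j hij ↦ altProd_TH b hij)
    (by rw [h1, len_s_mul_of_isPos b h, List.length_cons, length_redWord])
    (by rw [wprod_redWord, length_redWord]) (by rw [h1, wprod_redWord])
  rwa [List.map_cons, List.prod_cons] at h2

theorem TH_mul_TW_of_not_isPos {i : b.support} {w : Φ.weylGroup}
    (h : ¬ b.IsPos (w⁻¹ • (i : ι))) :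
    TH b i * TW b w = qSub • TW b w + TW b (s Φ i * w) := by
  have hs : s Φ (i : ι) * (s Φ i * w) = w := by rw [← mul_assoc, s_mul_self, one_mul]
  have hp : b.IsPos ((s Φ (i : ι) * w)⁻¹ • (i : ι)) := by
    by_contra hp
    have h1 := len_s_mul_of_not_isPos b h
    have h2 := len_s_mul_of_not_isPos b hp
    rw [hs] at h2
    omega
  have := TH_mul_TW_of_isPos b hp
  rw [hs] at this
  rw [← this, ← mul_assoc, TH_mul_self, add_mul, smul_mul_assoc, one_mul]

/-- The combination `∑ f_w T_w`. -/
def comb : (Φ.weylGroup → WeightAlgebra Φ) →ₗ[GroundRing] HeckeAlgebra b where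
  toFun φ := ∑ w, ofWeightAlgebra b (φ w) * TW b w
  map_add' φ ψ := by simp only [Pi.add_apply, map_add, add_mul, Finset.sum_add_distrib]
  map_smul' c φ := by
    simp only [Pi.smul_apply, map_smul, smul_mul_assoc, Finset.smul_sum, RingHom.id_apply]

theorem comb_apply (φ : Φ.weylGroup → WeightAlgebra Φ) :
    comb b φ = ∑ w, ofWeightAlgebra b (φ w) * TW b w := rfl

theorem mul_TW_mem_range_comb (f : WeightAlgebra Φ) (w : Φ.weylGroup) :
    ofWeightAlgebra b f * TW b w ∈ LinearMap.range (comb b) := by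
  classical
  refine ⟨Pi.single w f, ?_⟩
  rw [comb_apply, Finset.sum_eq_single w (fun u _ hu ↦ by simp [hu]) (by simp), Pi.single_eq_same]

theorem ofWeightAlgebra_mul_mem_range_comb (f : WeightAlgebra Φ) {y : HeckeAlgebra b}
    (hy : y ∈ LinearMap.range (comb b)) :
    ofWeightAlgebra b f * y ∈ LinearMap.range (comb b) := by
  obtain ⟨φ, rfl⟩ := hy
  refine ⟨fun w ↦ f * φ w, ?_⟩
  simp only [comb_apply, map_mul, mul_assoc, Finset.mul_sum]

theorem TH_mul_mem_range_comb (i : b.support) {y : HeckeAlgebra b}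
    (hy : y ∈ LinearMap.range (comb b)) : TH b i * y ∈ LinearMap.range (comb b) := by
  obtain ⟨φ, rfl⟩ := hy
  rw [comb_apply, Finset.mul_sum]
  refine Submodule.sum_mem _ fun w _ ↦ ?_
  obtain ⟨g, hg, -⟩ := exists_TH_mul_ofWeightAlgebra b i (φ w)
  rw [← mul_assoc, hg, add_mul, mul_assoc, smul_mul_assoc]
  refine add_mem (ofWeightAlgebra_mul_mem_range_comb b _ ?_)
    (Submodule.smul_mem _ _ (mul_TW_mem_range_comb b _ _))
  have hTW (u : Φ.weylGroup) : TW b u ∈ LinearMap.range (comb b) := by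
    have := mul_TW_mem_range_comb b 1 u
    rwa [map_one, one_mul] at this
  by_cases h : b.IsPos (w⁻¹ • (i : ι))
  · rw [TH_mul_TW_of_isPos b h]
    exact hTW _
  · rw [TH_mul_TW_of_not_isPos b h]
    exact add_mem (Submodule.smul_mem _ _ (hTW _)) (hTW _)

/-- The combinations form a left ideal, stable under all generators, and it contains 1 = T_1. -/
theorem comb_surjective : Function.Surjective (comb b) := by
  have key (y : HeckeAlgebra b) : ∀ z ∈ LinearMap.range (comb b),
      y * z ∈ LinearMap.range (comb b) := by
    induction y using heckeAlgebra_induction with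
    | hc c =>
      intro z hz
      rw [← Algebra.smul_def]
      exact Submodule.smul_mem _ _ hz
    | hT i => exact fun z ↦ TH_mul_mem_range_comb b i
    | hx f => exact fun z ↦ ofWeightAlgebra_mul_mem_range_comb b f
    | hmul y y' hy hy' =>
      intro z hz
      rw [mul_assoc]
      exact hy _ (hy' z hz)
    | hadd y y' hy hy' =>
      intro z hz
      rw [add_mul]
      exact add_mem (hy z hz) (hy' z hz)
  intro y
  have h1 := mul_TW_mem_range_comb b 1 1
  rw [map_one, one_mul, TW_one] at h1
  have := key y 1 h1
  rwa [mul_one] at this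

end Spanning

/-! ### Triangularity of T_w and determination of the center. -/

section Center

variable {ι V N : Type*} [AddCommGroup V] [Module ℝ V] [AddCommGroup N] [Module ℝ N]
  {Φ : RootPairing ι ℝ V N} [Φ.IsCrystallographic] [Finite ι] [Φ.IsRootSystem] [Φ.IsReduced]
  (b : Φ.Base)

/-- The operator of `T_w` is a combination of the elements of `W` of length less than that of `w`
and of `w` itself, with a nonzero coefficient at `w`. -/
theorem exists_coeff_TW (w : Φ.weylGroup) : ∃ g : Φ.weylGroup → WeightField Φ,
    (∀ f, rho b (TW b w) f = ∑ u, g u * actF u f) ∧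
    (∀ u, g u ≠ 0 → len b u < len b w ∨ u = w) ∧ g w ≠ 0 := by
  obtain ⟨g, hg, -, hlt, hw⟩ := exists_coeff b (redWord b w)
  rw [length_redWord, wprod_redWord] at hlt hw
  refine ⟨g, fun f ↦ ?_, hlt, ?_⟩
  · rw [← hg, TW, map_list_prod, List.map_map]
    congr 3
    funext i
    exact rho_TH b i
  · rw [hw rfl]
    exact mul_ne_zero (pow_ne_zero _ (inv_ne_zero qF_ne_zero)) (cInv_ne_zero b w)

/-- A combination `∑ f_w T_w` commuting with all `x^v` lies in `𝕂[P]`. -/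
theorem eq_zero_of_comb_commute {φ : Φ.weylGroup → WeightAlgebra Φ}
    (h : ∀ f, comb b φ * ofWeightAlgebra b f = ofWeightAlgebra b f * comb b φ)
    {w : Φ.weylGroup} (hw : w ≠ 1) : φ w = 0 := by
  choose g hg hlt hne using exists_coeff_TW b
  set G : Φ.weylGroup → WeightField Φ :=
    fun u ↦ ∑ w, algebraMap (WeightAlgebra Φ) (WeightField Φ) (φ w) * g w u with hG
  have hrho (f : WeightField Φ) : rho b (comb b φ) f = ∑ u, G u * actF u f := by
    simp only [hG, comb_apply, map_sum, map_mul, rho_ofWeightAlgebra, LinearMap.sum_apply,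
      Module.End.mul_apply, mulF_apply, hg, Finset.sum_mul, mul_assoc]
    exact Finset.sum_comm
  -- Commutation with x^v, compared at each u by independence.
  have hGv (v : weightLattice Φ) (u : Φ.weylGroup) :
      G u * (xF (weylMap Φ u v) - xF v) = 0 := by
    refine eq_zero_of_sum_actF (g := fun u ↦ G u * (xF (weylMap Φ u v) - xF v)) (fun f ↦ ?_) u
    have := congrArg (fun y ↦ rho b y f) (h (xP v))
    simp only [map_mul, Module.End.mul_apply, rho_ofWeightAlgebra, mulF_apply, hrho] at this
    change ∑ u, G u * (actF u (xF v) * actF u f) = xF v * _ at this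
    rw [← sub_eq_zero, Finset.mul_sum, ← Finset.sum_sub_distrib] at this
    rw [← this]
    refine Finset.sum_congr rfl fun u _ ↦ ?_
    rw [actF_xF]
    ring
  have hG0 (u : Φ.weylGroup) (hu : u ≠ 1) : G u = 0 := by
    by_contra h0
    refine hu (eq_of_weylMap_eq fun v ↦ ?_)
    have := (mul_eq_zero.1 (hGv v u)).resolve_left h0
    rw [weylMap_one]
    exact xF_injective (sub_eq_zero.1 this)
  -- At a longest w₀ ≠ 1 with φ w₀ ≠ 0, any other T_u contributing to G w₀ would have u longer than
  -- w₀, hence u ≠ 1 and φ u ≠ 0, against maximality. So G w₀ is a single nonzero product.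
  by_contra hφ
  obtain ⟨w₀, ⟨h1, h2⟩, hmax⟩ := Set.exists_max_image {w | w ≠ 1 ∧ φ w ≠ 0} (len b)
    (Set.toFinite _) ⟨w, hw, hφ⟩
  have h3 := hG0 w₀ h1
  rw [hG] at h3
  simp only at h3
  rw [Finset.sum_eq_single w₀ (fun u _ hu ↦ ?_) (by simp)] at h3
  · exact mul_ne_zero ((map_ne_zero_iff _ (IsFractionRing.injective _ _)).2 h2) (hne w₀) h3
  · by_contra h4
    obtain ⟨h5, h6⟩ := mul_ne_zero_iff.1 h4
    have h7 := (hlt u w₀ h6).resolve_right (Ne.symm hu)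
    have h8 : u ≠ 1 := by
      rintro rfl
      rw [len_one] at h7
      exact Nat.not_lt_zero _ h7
    exact absurd (hmax u ⟨h8, fun h9 ↦ h5 (by rw [h9, map_zero])⟩) (not_le.2 h7)

/-- Evaluated at 1, where T_i acts by q, commutation says q⁻¹ c_i (s_i f - f) = 0, and c_i is
nonzero. -/
theorem weylAct_s_eq_of_commute {i : b.support} {f : WeightAlgebra Φ}
    (h : TH b i * ofWeightAlgebra b f = ofWeightAlgebra b f * TH b i) :
    weylAct Φ (s Φ (i : ι)) f = f := by
  have := congrArg (fun y ↦ rho b y 1) h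
  simp only [map_mul, Module.End.mul_apply, rho_ofWeightAlgebra, mulF_apply, rho_TH, demLus_apply,
    dl, mul_one, actF_algebraMap, map_one] at this
  have hc := mul_ne_zero (inv_ne_zero (qF_ne_zero (Φ := Φ)))
    (cF_ne_zero (rootWeight_ne_zero (Φ := Φ) (i : ι)))
  refine IsFractionRing.injective (WeightAlgebra Φ) (WeightField Φ) (mul_left_cancel₀ hc ?_)
  linear_combination this

theorem center_eq_map_invariants :
    Subalgebra.center GroundRing (HeckeAlgebra b) =
      (invariants Φ).map (ofWeightAlgebra b) := by
  ext z
  rw [Subalgebra.mem_center_iff, Subalgebra.mem_map]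
  constructor
  · intro hz
    obtain ⟨φ, rfl⟩ := comb_surjective b z
    have hφ : comb b φ = ofWeightAlgebra b (φ 1) := by
      rw [comb_apply, Finset.sum_eq_single 1 (fun w _ hw ↦ ?_) (by simp), TW_one, mul_one]
      rw [eq_zero_of_comb_commute b (fun f ↦ (hz _).symm) hw, map_zero, zero_mul]
    rw [hφ] at hz ⊢
    exact ⟨φ 1, mem_invariants_of_simple b fun i ↦ weylAct_s_eq_of_commute b (hz _), rfl⟩
  · rintro ⟨f, hf, rfl⟩ y
    induction y using heckeAlgebra_induction with
    | hc c => exact Algebra.commutes _ _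
    | hT i => exact TH_commute_of_weylAct_s_eq b (hf _)
    | hx g => exact (map_mul _ _ _).symm.trans ((congrArg _ (mul_comm g f)).trans (map_mul _ _ _))
    | hmul y y' hy hy' => rw [mul_assoc, hy', ← mul_assoc, hy, mul_assoc]
    | hadd y y' hy hy' => rw [add_mul, mul_add, hy, hy']

end Center

end AffineHecke

end

theorem theorem1p33 {ι V N : Type*} [Finite ι] [AddCommGroup V] [Module ℝ V]
    [AddCommGroup N] [Module ℝ N] (Φ : RootPairing ι ℝ V N) [Φ.IsRootSystem]
    [Φ.IsCrystallographic] [Φ.IsReduced] [Φ.IsIrreducible] (b : Φ.Base) :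
    Function.Injective (AffineHecke.ofWeightAlgebra b) ∧
      Subalgebra.center AffineHecke.GroundRing (AffineHecke.HeckeAlgebra b) =
        (AffineHecke.invariants Φ).map (AffineHecke.ofWeightAlgebra b) :=
  ⟨AffineHecke.ofWeightAlgebra_injective b, AffineHecke.center_eq_map_invariants b⟩
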